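/- Let $p>2$, let $h:[0,\infty)\to[0,\infty)$ be a $C^1$ function that is positive for all large arguments, and put $f(t)=h(t)e^{t^p}$. Assume that there are constants $c_0,\tau_0>0$ and $m\in\mathbb{R}$ such that $f(t)=c_0t^me^{t^p}$ for all $t\ge\tau_0$. For $\beta>0$ and $L\in\mathbb{R}$ put, for small $r>0$, $$U_\beta(r)=\Big(\beta\log\frac1r\Big)^{1/p},\qquad V_L(r)=\Big\{2\log\frac1r-\Big(1-\frac{1-m}{p}\Big)\log\Big(2\log\frac1r\Big)+L\Big\}^{1/p}.$$ For each $n\in\mathbb{N}$ let $\bar r_n>0$, $\bar\mu_n\in\mathbb{R}$, and let $\bar u_n$ be a classical solution of $$-\bar u_n''-\frac1r\bar u_n'=f(\bar u_n),\quad \bar u_n>0\ \text{ in }(0,\bar r_n),\qquad \bar u_n(0)=\bar\mu_n,\quad \bar u_n'(0)=0=\bar u_n(\bar r_n),$$ and suppose that $\bar\mu_n\to\infty$ as $n\to\infty$. Let $\bar U$ be a continuous function on an interval $(0,d)$, $d>0$, such that for all $\varepsilon\in(0,2)$ and $L\in\mathbb{R}$ there is $r_0\in(0,1)$ with $$U_{2-\varepsilon}(r)\le\bar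 U(r)\le V_L(r)\qquad\text{for all } r\in(0,r_0).$$ Then, for every sequence $(r_n)$ with $r_n\in(0,\bar r_n]$ and $\bar\mu_n^{-p}\log(1/r_n)\to0$ as $n\to\infty$, the number (in $\mathbb{N}\cup\{\infty\}$) of zeros of $\bar u_n-\bar U$ on $(0,r_n)\cap(0,d)$ tends to $\infty$ as $n\to\infty$. -/

import Mathlib

open Set Filter Topology

noncomputable section

/-- The nonlinearity `f(t) = h(t) exp(t ^ p)`; only its values at `t ≥ 0` matter. -/
def nonlin (p : ℝ) (h : ℝ → ℝ) (t : ℝ) : ℝ := h t * Real.exp (t ^ p)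

/-- The standing assumption on the factor `h`: it is a nonnegative `C¹` function on `[0, ∞)`
which is positive for all large arguments. -/
structure StandingAssumption (h : ℝ → ℝ) : Prop where
  contDiffOn : ContDiffOn ℝ 1 h (Ici 0)
  nonneg : ∀ t, 0 ≤ t → 0 ≤ h t
  pos_of_large : ∃ t₀ : ℝ, 0 < t₀ ∧ ∀ t, t₀ ≤ t → 0 < h t

/-- `u` is a classical solution of
`-u'' - u' / r = f(u)`, `u > 0` in `(0, R)`, `u(0) = μ`, `u'(0) = 0 = u(R)`.
The derivative at the end point `0` is one-sided. -/
structure IsRadialSolution (f : ℝ → ℝ) (R μ : ℝ) (u : ℝ → ℝ) : Prop where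
  radius_pos : 0 < R
  continuousOn : ContinuousOn u (Icc 0 R)
  contDiffOn : ContDiffOn ℝ 2 u (Ioo 0 R)
  equation : ∀ r ∈ Ioo 0 R, -(deriv (deriv u) r) - (1 / r) * deriv u r = f (u r)
  pos : ∀ r ∈ Ioo 0 R, 0 < u r
  value_zero : u 0 = μ
  deriv_zero : HasDerivWithinAt u 0 (Icc 0 R) 0
  value_radius : u R = 0

/-- `U_β(r) = (β log (1 / r)) ^ (1 / p)`, for `r ∈ (0, 1]`. -/
def lowerCurve (p β r : ℝ) : ℝ := (β * Real.log (1 / r)) ^ (1 / p)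

/-- `V_L(r) = (2 log (1 / r) - (1 - (1 - m) / p) log (2 log (1 / r)) + L) ^ (1 / p)`,
for small `r > 0` (for each `L` the base is positive when `r` is small enough). -/
def upperCurve (p m L r : ℝ) : ℝ :=
  (2 * Real.log (1 / r) - (1 - (1 - m) / p) * Real.log (2 * Real.log (1 / r)) + L) ^ (1 / p)

/-- The number of zeros of `w` on the set `I`, with value `⊤` if there are infinitely many. -/
def zeroNumber (I : Set ℝ) (w : ℝ → ℝ) : ℕ∞ := {r ∈ I | w r = 0}.encard

end

/-! With r = exp(-μ^p s) and v = u / μ, the profile v is concave and nondecreasing in s and tends to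
1. The hypothesis on `r n` says that the zeros are counted over s-ranges whose left ends tend to at
most 0. The curve U_β becomes v^p = β s, and V_L is a logarithmic correction of the critical curve
v^p = 2s. So the profiles must be shown to oscillate about the critical curve.

Let γ = (v^p - 2s)' (`phaseRate`) and let F (`bubbleDensity`) be the rescaled nonlinearity. On
compact s-ranges γ' = O(1) - μ^p F and F' = O(1) F + μ^p F γ, so the large terms cancel in E = γ²/2
+ F, and E is Lipschitz uniformly in μ (`abs_bubbleEnergy_sub_le`). In the limit, V is concave, V^p
≤ 2s, and V is affine where the inequality is strict. At a contact with the critical curve γ is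
reflected, because F vanishes in the limit on both sides and γ²/2 is continuous across.

The first contact is s = 1/2, with V = 1 to its right. To the left of a contact there is always
another (`exists_next_contact`): otherwise the line would run down to s = 0 with nonpositive
intercept, forcing γ ≥ 2p - 2 > 2, while the energy bound gives |γ| ≤ 2. This is where p > 2 enters.
Hence there are infinitely many contacts.

Just left of a contact the profile lies below some U_{2-ε}. Near the contact γ vanishes somewhere,
there F = E is bounded below (`exists_bubble`), and this puts the profile above some V_L
(`exists_upperCurve_lt`). The intermediate value theorem gives a zero near every contact. -/

/-! ### Rescaled profiles and their concavity -/

/-- The logarithmic rescaling `v` of a radial solution, with derivative `d`. -/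
structure LogProfile (f : ℝ → ℝ) (p μ s₀ : ℝ) (v d : ℝ → ℝ) : Prop where
  hasDerivAt : ∀ s, s₀ < s → HasDerivAt v (d s) s
  hasDerivAt_deriv : ∀ s, s₀ < s →
    HasDerivAt d (-(μ ^ (2 * p - 1) * Real.exp (-(2 * μ ^ p * s)) * f (μ * v s))) s
  pos : ∀ s, s₀ < s → 0 < v s
  tendsto_one : Tendsto v atTop (𝓝 1)

/-- Substituting `r = exp (-μ ^ p s)` in a radial solution and dividing by `μ` gives a profile. -/
theorem IsRadialSolution.logProfile {f : ℝ → ℝ} {p R μ : ℝ} {u : ℝ → ℝ} (hμ : 0 < μ)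
    (hu : IsRadialSolution f R μ u) :
    LogProfile f p μ (μ ^ (-p) * Real.log (1 / R)) (fun s => u (Real.exp (-(μ ^ p * s))) / μ)
      (fun s => -(μ ^ (p - 1) * (Real.exp (-(μ ^ p * s)) * deriv u (Real.exp (-(μ ^ p * s)))))) := by
  have hR := hu.radius_pos
  have hΛ : 0 < μ ^ p := Real.rpow_pos_of_pos hμ p
  have hmem : ∀ s, μ ^ (-p) * Real.log (1 / R) < s → Real.exp (-(μ ^ p * s)) ∈ Ioo 0 R := by
    intro s hs
    refine ⟨Real.exp_pos _, ?_⟩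
    rw [← Real.lt_log_iff_exp_lt hR]
    rw [Real.rpow_neg hμ.le, inv_mul_lt_iff₀ hΛ, one_div, Real.log_inv] at hs
    linarith
  have hμp : μ ^ p = μ ^ (p - 1) * μ := by
    rw [Real.rpow_sub_one hμ.ne']; field_simp
  have hexp : ∀ s, HasDerivAt (fun s => Real.exp (-(μ ^ p * s)))
      (Real.exp (-(μ ^ p * s)) * (-(μ ^ p))) s := by
    intro s
    have := ((hasDerivAt_id s).const_mul (μ ^ p)).neg.exp
    simpa using this
  have hu1 : ∀ r ∈ Ioo 0 R, HasDerivAt u (deriv u r) r := by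
    intro r hr
    exact ((hu.contDiffOn.contDiffAt (isOpen_Ioo.mem_nhds hr)).differentiableAt
      (by norm_num)).hasDerivAt
  have hu2 : ∀ r ∈ Ioo 0 R, HasDerivAt (deriv u) (deriv (deriv u) r) r := by
    intro r hr
    have h1 : ContDiffOn ℝ 1 (deriv u) (Ioo 0 R) :=
      hu.contDiffOn.deriv_of_isOpen isOpen_Ioo (by norm_num)
    exact ((h1.contDiffAt (isOpen_Ioo.mem_nhds hr)).differentiableAt (by norm_num)).hasDerivAt
  refine ⟨fun s hs => ?_, fun s hs => ?_, fun s hs => ?_, ?_⟩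
  · have h1 := ((hu1 _ (hmem s hs)).comp s (hexp s)).div_const μ
    refine h1.congr_deriv ?_
    rw [hμp]; field_simp
  · have hm := hmem s hs
    have h1 := (((hexp s).mul ((hu2 _ hm).comp s (hexp s))).const_mul (μ ^ (p - 1))).neg
    refine h1.congr_deriv ?_
    have e1 : Real.exp (-(2 * μ ^ p * s)) = Real.exp (-(μ ^ p * s)) * Real.exp (-(μ ^ p * s)) := by
      rw [← Real.exp_add]; congr 1; ring
    have e2 : μ ^ (2 * p - 1) = μ ^ (p - 1) * μ ^ p := by
      rw [← Real.rpow_add hμ]; congr 1; ring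
    have h3 := hu.equation _ hm
    have e3 : μ * (u (Real.exp (-(μ ^ p * s))) / μ) = u (Real.exp (-(μ ^ p * s))) := by
      field_simp
    rw [e1, e2, e3, ← h3]
    have := (hm.1).ne'
    simp only [Function.comp_apply]
    field_simp
    ring
  · exact div_pos (hu.pos _ (hmem s hs)) hμ
  · have h0 : Tendsto (fun s => Real.exp (-(μ ^ p * s))) atTop (𝓝[Icc 0 R] 0) := by
      refine tendsto_nhdsWithin_iff.2 ⟨?_, ?_⟩
      · exact Real.tendsto_exp_neg_atTop_nhds_zero.comp (tendsto_id.const_mul_atTop hΛ)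
      · filter_upwards [eventually_gt_atTop (μ ^ (-p) * Real.log (1 / R))] with s hs
        exact Ioo_subset_Icc_self (hmem s hs)
    have h1 := ((hu.continuousOn 0 ⟨le_rfl, hR.le⟩).tendsto.comp h0).div_const μ
    rw [hu.value_zero, div_self hμ.ne'] at h1
    exact h1

namespace LogProfile

variable {f : ℝ → ℝ} {p μ s₀ : ℝ} {v d : ℝ → ℝ}

theorem antitoneOn (P : LogProfile f p μ s₀ v d) (hμ : 0 < μ) (hf : ∀ t, 0 ≤ t → 0 ≤ f t) :
    AntitoneOn d (Ioi s₀) := by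
  refine antitoneOn_of_deriv_nonpos (convex_Ioi s₀)
    (fun s hs => (P.hasDerivAt_deriv s hs).continuousAt.continuousWithinAt) ?_ ?_
  · intro s hs
    rw [interior_Ioi] at hs
    exact (P.hasDerivAt_deriv s hs).differentiableAt.differentiableWithinAt
  · intro s hs
    rw [interior_Ioi] at hs
    rw [(P.hasDerivAt_deriv s hs).deriv]
    have := hf (μ * v s) (mul_pos hμ (P.pos s hs)).le
    have := Real.rpow_pos_of_pos hμ (2 * p - 1)
    have : 0 ≤ μ ^ (2 * p - 1) * Real.exp (-(2 * μ ^ p * s)) * f (μ * v s) := by positivity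
    linarith

theorem le_add_mul (P : LogProfile f p μ s₀ v d) (hμ : 0 < μ) (hf : ∀ t, 0 ≤ t → 0 ≤ f t)
    {x y : ℝ} (hx : s₀ < x) (hy : s₀ < y) : v y ≤ v x + d x * (y - x) := by
  have hanti := P.antitoneOn hμ hf
  rcases lt_trichotomy x y with hxy | rfl | hxy
  · obtain ⟨c, hc, h⟩ := exists_hasDerivAt_eq_slope v d hxy
      (fun s hs => (P.hasDerivAt s (hx.trans_le hs.1)).continuousAt.continuousWithinAt)
      (fun s hs => P.hasDerivAt s (hx.trans hs.1))
    have := hanti hx (hx.trans hc.1) hc.1.le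
    rw [h, div_le_iff₀ (by linarith)] at this
    linarith
  · simp
  · obtain ⟨c, hc, h⟩ := exists_hasDerivAt_eq_slope v d hxy
      (fun s hs => (P.hasDerivAt s (hy.trans_le hs.1)).continuousAt.continuousWithinAt)
      (fun s hs => P.hasDerivAt s (hy.trans hs.1))
    have := hanti (hy.trans hc.1) hx hc.2.le
    rw [h, le_div_iff₀ (by linarith)] at this
    linarith

/-- A concave function with a negative slope somewhere reaches zero in finite time, whereas `v` is
positive on a half-line. -/
theorem deriv_nonneg (P : LogProfile f p μ s₀ v d) (hμ : 0 < μ) (hf : ∀ t, 0 ≤ t → 0 ≤ f t)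
    {x : ℝ} (hx : s₀ < x) : 0 ≤ d x := by
  by_contra! h
  have hv := P.pos x hx
  have hy : x < x + v x / (-d x) := by
    have : 0 < v x / (-d x) := div_pos hv (by linarith)
    linarith
  have h1 := P.le_add_mul hμ hf hx (hx.trans hy)
  have h2 := P.pos _ (hx.trans hy)
  have : d x * (x + v x / (-d x) - x) = - v x := by
    field_simp [h.ne]; ring
  linarith

theorem monotoneOn (P : LogProfile f p μ s₀ v d) (hμ : 0 < μ) (hf : ∀ t, 0 ≤ t → 0 ≤ f t) :
    MonotoneOn v (Ioi s₀) := by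
  intro x hx y hy hxy
  have h1 := P.le_add_mul hμ hf hy hx
  have := mul_nonneg (P.deriv_nonneg hμ hf hy) (sub_nonneg.2 hxy)
  linarith

theorem le_one (P : LogProfile f p μ s₀ v d) (hμ : 0 < μ) (hf : ∀ t, 0 ≤ t → 0 ≤ f t)
    {x : ℝ} (hx : s₀ < x) : v x ≤ 1 := by
  refine ge_of_tendsto P.tendsto_one ?_
  filter_upwards [eventually_ge_atTop x] with y hy
  exact P.monotoneOn hμ hf hx (hx.trans_le hy) hy

theorem deriv_mul_le (P : LogProfile f p μ s₀ v d) (hμ : 0 < μ) (hf : ∀ t, 0 ≤ t → 0 ≤ f t)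
    {x y : ℝ} (hx : s₀ < x) (hy : s₀ < y) : d x * (x - y) ≤ v x := by
  have h1 := P.le_add_mul hμ hf hx hy
  have := P.pos y hy
  linarith

theorem deriv_le (P : LogProfile f p μ s₀ v d) (hμ : 0 < μ) (hf : ∀ t, 0 ≤ t → 0 ≤ f t)
    {a x : ℝ} (ha : 0 < a) (has : s₀ < a / 2) (hx : a ≤ x) : d x ≤ 2 / a := by
  have h1 := P.deriv_mul_le hμ hf (x := x) (y := a / 2) (by linarith) has
  have h2 := P.le_one hμ hf (x := x) (by linarith)
  have h3 := P.deriv_nonneg hμ hf (x := x) (by linarith)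
  rw [le_div_iff₀ ha]
  nlinarith

/-- The tangent at `x`, followed back to `a / 2`, bounds the slope by the height; followed forward
to `1`, it then bounds `v 1` by a multiple of `v x`. -/
theorem half_mul_le (P : LogProfile f p μ s₀ v d) (hμ : 0 < μ) (hf : ∀ t, 0 ≤ t → 0 ≤ f t)
    {a x : ℝ} (ha : 0 < a) (has : s₀ < a / 2) (hx : a ≤ x) (hx1 : x ≤ 1) :
    a / 2 * v 1 ≤ v x := by
  have h1 := P.deriv_mul_le hμ hf (x := x) (y := a / 2) (by linarith) has
  have h2 := P.le_add_mul hμ hf (x := x) (y := 1) (by linarith) (by linarith)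
  have h3 := P.deriv_nonneg hμ hf (x := x) (by linarith)
  have h4 := P.pos x (by linarith)
  have h5 : d x * (x - a / 2) * (1 - x) ≤ v x * (1 - x) :=
    mul_le_mul_of_nonneg_right h1 (by linarith)
  have h6 : v 1 * (x - a / 2) ≤ (v x + d x * (1 - x)) * (x - a / 2) :=
    mul_le_mul_of_nonneg_right h2 (by linarith)
  have h7 : v 1 * (x - a / 2) ≤ v x := by nlinarith
  have h8 := P.pos 1 (by linarith)
  nlinarith

theorem tendsto_deriv (P : LogProfile f p μ s₀ v d) (hμ : 0 < μ) (hf : ∀ t, 0 ≤ t → 0 ≤ f t) :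
    Tendsto d atTop (𝓝 0) := by
  have h1 : Tendsto (fun x : ℝ => (x - (s₀ + 1))⁻¹) atTop (𝓝 0) :=
    tendsto_inv_atTop_zero.comp (tendsto_atTop_add_const_right _ _ tendsto_id)
  refine tendsto_of_tendsto_of_tendsto_of_le_of_le' tendsto_const_nhds h1 ?_ ?_
  · filter_upwards [eventually_gt_atTop s₀] with x hx
    exact P.deriv_nonneg hμ hf hx
  · filter_upwards [eventually_gt_atTop (s₀ + 1)] with x hx
    have h2 := P.deriv_mul_le hμ hf (x := x) (y := s₀ + 1) (by linarith) (by linarith)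
    have h3 := P.le_one hμ hf (x := x) (by linarith)
    rw [← one_div, le_div_iff₀ (by linarith)]
    linarith

/-- Integrate the equation twice from infinity, where `d` tends to 0 and `v` to 1, with `f` replaced
by its bound `M`. -/
theorem one_sub_le (P : LogProfile f p μ s₀ v d) (hμ : 0 < μ) (hf : ∀ t, 0 ≤ t → 0 ≤ f t)
    {M : ℝ} (hM : ∀ t, 0 ≤ t → t ≤ μ → f t ≤ M) {x : ℝ} (hx : s₀ < x) :
    1 - M / (4 * μ) * Real.exp (-(2 * μ ^ p * x)) ≤ v x := by
  have hΛ : 0 < μ ^ p := Real.rpow_pos_of_pos hμ p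
  have hpow : μ ^ (2 * p - 1) = μ ^ p * μ ^ p / μ := by
    rw [Real.rpow_sub_one hμ.ne', two_mul, Real.rpow_add hμ]
  have hexp : ∀ c s : ℝ, HasDerivAt (fun s => c * Real.exp (-(2 * μ ^ p * s)))
      (c * (Real.exp (-(2 * μ ^ p * s)) * (-(2 * μ ^ p)))) s := by
    intro c s
    have := (((hasDerivAt_id s).const_mul (2 * μ ^ p)).neg.exp).const_mul c
    simpa using this
  have hlim : ∀ c : ℝ, Tendsto (fun s => c * Real.exp (-(2 * μ ^ p * s))) atTop (𝓝 0) := by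
    intro c
    have := (Real.tendsto_exp_neg_atTop_nhds_zero.comp
      ((tendsto_id (α := ℝ) (x := atTop)).const_mul_atTop
        (show 0 < 2 * μ ^ p by positivity))).const_mul c
    simpa using this
  have hd : ∀ s, s₀ < s → d s ≤ M * μ ^ p / (2 * μ) * Real.exp (-(2 * μ ^ p * s)) := by
    have hmono : MonotoneOn (fun s => d s - M * μ ^ p / (2 * μ) * Real.exp (-(2 * μ ^ p * s)))
        (Ioi s₀) := by
      have hder : ∀ s, s₀ < s → HasDerivAt
          (fun s => d s - M * μ ^ p / (2 * μ) * Real.exp (-(2 * μ ^ p * s)))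
          (μ ^ (2 * p - 1) * Real.exp (-(2 * μ ^ p * s)) * (M - f (μ * v s))) s := by
        intro s hs
        refine ((P.hasDerivAt_deriv s hs).sub (hexp _ s)).congr_deriv ?_
        rw [hpow]; field_simp; ring
      refine monotoneOn_of_deriv_nonneg (convex_Ioi s₀)
        (fun s hs => (hder s hs).continuousAt.continuousWithinAt) ?_ ?_
      · intro s hs
        rw [interior_Ioi] at hs
        exact (hder s hs).differentiableAt.differentiableWithinAt
      · intro s hs
        rw [interior_Ioi] at hs
        rw [(hder s hs).deriv]
        have h1 := hM (μ * v s) (mul_pos hμ (P.pos s hs)).le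
          (mul_le_of_le_one_right hμ.le (P.le_one hμ hf hs))
        have := Real.rpow_pos_of_pos hμ (2 * p - 1)
        have : 0 ≤ M - f (μ * v s) := by linarith
        positivity
    intro s hs
    have h1 := (P.tendsto_deriv hμ hf).sub (hlim (M * μ ^ p / (2 * μ)))
    rw [sub_zero] at h1
    have h2 := ge_of_tendsto h1 (by
      filter_upwards [eventually_ge_atTop s] with y hy
      exact hmono hs (hs.trans_le hy) hy)
    simp only at h2
    linarith
  have hanti : AntitoneOn (fun s => v s + M / (4 * μ) * Real.exp (-(2 * μ ^ p * s))) (Ioi s₀) := by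
    have hder : ∀ s, s₀ < s → HasDerivAt
        (fun s => v s + M / (4 * μ) * Real.exp (-(2 * μ ^ p * s)))
        (d s - M * μ ^ p / (2 * μ) * Real.exp (-(2 * μ ^ p * s))) s := by
      intro s hs
      refine ((P.hasDerivAt s hs).add (hexp _ s)).congr_deriv ?_
      field_simp; ring
    refine antitoneOn_of_deriv_nonpos (convex_Ioi s₀)
      (fun s hs => (hder s hs).continuousAt.continuousWithinAt) ?_ ?_
    · intro s hs
      rw [interior_Ioi] at hs
      exact (hder s hs).differentiableAt.differentiableWithinAt
    · intro s hs
      rw [interior_Ioi] at hs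
      rw [(hder s hs).deriv]
      linarith [hd s hs]
  have h1 := P.tendsto_one.add (hlim (M / (4 * μ)))
  rw [add_zero] at h1
  have h2 := le_of_tendsto h1 (by
    filter_upwards [eventually_ge_atTop x] with y hy
    exact hanti hx (hx.trans_le hy) hy)
  simp only at h2
  linarith

end LogProfile

/-! ### Phase rate, bubble density and the slowly varying energy -/

noncomputable section

/-- The derivative of `s ↦ v s ^ p - 2 * s`, where `v s = x` and `v' s = y`. -/
def phaseRate (p x y : ℝ) : ℝ := p * x ^ (p - 1) * y - 2

/-- The rescaled nonlinearity at the value `x = v s` of a profile. -/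
def bubbleDensity (p m c₀ μ x s : ℝ) : ℝ :=
  p * c₀ * (μ ^ (m + p - 1) * x ^ (m + p - 1)) * Real.exp (μ ^ p * (x ^ p - 2 * s))

/-- The energy of a profile, which varies slowly. -/
def bubbleEnergy (p m c₀ μ x y s : ℝ) : ℝ :=
  phaseRate p x y ^ 2 / 2 + bubbleDensity p m c₀ μ x s

theorem bubbleDensity_pos {p m c₀ μ x : ℝ} (s : ℝ) (hp : 0 < p) (hc : 0 < c₀) (hμ : 0 < μ)
    (hx : 0 < x) : 0 < bubbleDensity p m c₀ μ x s := by
  unfold bubbleDensity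
  have := Real.rpow_pos_of_pos hμ (m + p - 1)
  have := Real.rpow_pos_of_pos hx (m + p - 1)
  positivity

theorem exists_rpow_bounds (k : ℝ) {b : ℝ} (hb : 0 < b) :
    ∃ κ K : ℝ, 0 < κ ∧ 0 < K ∧ ∀ x, b ≤ x → x ≤ 1 → κ ≤ x ^ k ∧ x ^ k ≤ K := by
  rcases le_total 0 k with hk | hk
  · exact ⟨b ^ k, 1, Real.rpow_pos_of_pos hb k, one_pos, fun x h1 h2 =>
      ⟨Real.rpow_le_rpow hb.le h1 hk, Real.rpow_le_one (hb.le.trans h1) h2 hk⟩⟩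
  · exact ⟨1, b ^ k, one_pos, Real.rpow_pos_of_pos hb k, fun x h1 h2 =>
      ⟨Real.one_le_rpow_of_pos_of_le_one_of_nonpos (hb.trans_le h1) h2 hk,
        Real.rpow_le_rpow_of_nonpos hb h1 hk⟩⟩

theorem tendsto_rpow_mul_exp_neg {ι : Type*} {l : Filter ι} {μ : ι → ℝ} (hμ : Tendsto μ l atTop)
    {p η : ℝ} (hp : 0 < p) (hη : 0 < η) (k : ℝ) :
    Tendsto (fun n => μ n ^ k * Real.exp (-η * μ n ^ p)) l (𝓝 0) := by
  have h1 := (tendsto_rpow_mul_exp_neg_mul_atTop_nhds_zero (k / p) η hη).comp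
    ((tendsto_rpow_atTop hp).comp hμ)
  refine h1.congr' ?_
  filter_upwards [hμ.eventually_gt_atTop 0] with n hn
  simp only [Function.comp_apply]
  rw [← Real.rpow_mul hn.le, mul_div_cancel₀ _ hp.ne']

theorem tendsto_rpow_mul_exp_atTop {ι : Type*} {l : Filter ι} {μ : ι → ℝ}
    (hμ : Tendsto μ l atTop) {p η : ℝ} (hp : 0 < p) (hη : 0 < η) (k : ℝ) :
    Tendsto (fun n => μ n ^ k * Real.exp (η * μ n ^ p)) l atTop := by
  have h1 := tendsto_rpow_mul_exp_neg hμ hp hη (-k)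
  have h2 : Tendsto (fun n => μ n ^ (-k) * Real.exp (-η * μ n ^ p)) l (𝓝[>] 0) := by
    refine tendsto_nhdsWithin_iff.2 ⟨h1, ?_⟩
    filter_upwards [hμ.eventually_gt_atTop 0] with n hn
    exact mul_pos (Real.rpow_pos_of_pos hn _) (Real.exp_pos _)
  refine (tendsto_inv_nhdsGT_zero.comp h2).congr' ?_
  filter_upwards [hμ.eventually_gt_atTop 0] with n hn
  simp only [Function.comp_apply]
  rw [mul_inv, Real.rpow_neg hn.le, inv_inv, ← Real.exp_neg]
  congr 2; ring

/-- If `γ` decreases fast whenever `|γ| ≤ G`, then it drops from `G` to `-G` quickly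
and stays below `-G`. -/
theorem le_neg_of_steep {γ γ' : ℝ → ℝ} {x y G η : ℝ} (hG : 0 < G) (hη : 0 < η)
    (hd : ∀ s ∈ Icc x y, HasDerivAt γ (γ' s) s)
    (hsteep : ∀ s ∈ Icc x y, |γ s| ≤ G → γ' s < -(2 * G / η)) (hx : γ x ≤ G)
    {s : ℝ} (hs : s ∈ Icc (x + η) y) : γ s ≤ -G := by
  have hpos : 0 < 2 * G / η := by positivity
  have hmid : γ (x + η) ≤ -G := by
    have hB : ∀ t : ℝ, HasDerivAt (fun t => G - 2 * G / η * (t - x)) (-(2 * G / η)) t := by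
      intro t
      have := (((hasDerivAt_id t).sub_const x).const_mul (2 * G / η)).const_sub G
      simpa using this
    have hsub : ∀ t ∈ Icc x (x + η), t ∈ Icc x y := fun t ht => ⟨ht.1, ht.2.trans (hs.1.trans hs.2)⟩
    have := image_le_of_deriv_right_lt_deriv_boundary (a := x) (b := x + η) (f := γ) (f' := γ')
      (fun t ht => (hd t (hsub t ht)).continuousAt.continuousWithinAt)
      (fun t ht => (hd t (hsub t (Ico_subset_Icc_self ht))).hasDerivWithinAt)
      (B := fun t => G - 2 * G / η * (t - x)) (B' := fun _ => -(2 * G / η)) (by simpa using hx)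
      hB (fun t ht he => ?_) (right_mem_Icc.2 (by linarith))
    · simp only [add_sub_cancel_left] at this
      rw [div_mul_cancel₀ _ hη.ne'] at this
      linarith
    · refine hsteep t (hsub t (Ico_subset_Icc_self ht)) ?_
      have h1 : 0 ≤ 2 * G / η * (t - x) := mul_nonneg hpos.le (by linarith [ht.1])
      have h2 : 2 * G / η * (t - x) ≤ 2 * G / η * η :=
        mul_le_mul_of_nonneg_left (by linarith [ht.2]) hpos.le
      rw [div_mul_cancel₀ _ hη.ne'] at h2
      rw [he, abs_le]
      constructor <;> linarith
  have hsub : ∀ t ∈ Icc (x + η) s, t ∈ Icc x y :=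
    fun t ht => ⟨by linarith [ht.1], ht.2.trans hs.2⟩
  refine image_le_of_deriv_right_lt_deriv_boundary (a := x + η) (b := s) (f := γ) (f' := γ')
      (fun t ht => (hd t (hsub t ht)).continuousAt.continuousWithinAt)
      (fun t ht => (hd t (hsub t (Ico_subset_Icc_self ht))).hasDerivWithinAt)
      (B := fun t => -G) (B' := fun _ => 0) hmid
      (fun t => hasDerivAt_const t _) (fun t ht he => ?_) (right_mem_Icc.2 hs.1)
  have := hsteep t (hsub t (Ico_subset_Icc_self ht)) (by rw [he, abs_neg, abs_of_pos hG])
  linarith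

/-- On `[a, 1]` the profile solves the equation of the model nonlinearity,
with explicit bounds. -/
structure RegularProfile (p m c₀ μ a : ℝ) (v d : ℝ → ℝ) : Prop where
  pos : 0 < μ
  lower : ∀ s ∈ Icc a 1, a / 4 ≤ v s
  upper : ∀ s ∈ Icc a 1, v s ≤ 1
  deriv_nonneg : ∀ s ∈ Icc a 1, 0 ≤ d s
  deriv_le : ∀ s ∈ Icc a 1, d s ≤ 2 / a
  monotoneOn : MonotoneOn v (Icc a 1)
  le_add_mul : ∀ x ∈ Icc a 1, ∀ y ∈ Icc a 1, v y ≤ v x + d x * (y - x)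
  hasDerivAt : ∀ s ∈ Icc a 1, HasDerivAt v (d s) s
  hasDerivAt_deriv : ∀ s ∈ Icc a 1,
    HasDerivAt d (-(μ ^ p * bubbleDensity p m c₀ μ (v s) s / (p * v s ^ (p - 1)))) s

namespace RegularProfile

variable {p m c₀ μ a : ℝ} {v d : ℝ → ℝ}

theorem hasDerivAt_rpow_sub (P : RegularProfile p m c₀ μ a v d) (ha : 0 < a)
    {s : ℝ} (hs : s ∈ Icc a 1) :
    HasDerivAt (fun s => v s ^ p - 2 * s) (phaseRate p (v s) (d s)) s := by
  have hv : 0 < v s := lt_of_lt_of_le (by positivity) (P.lower s hs)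
  have h1 := ((P.hasDerivAt s hs).rpow_const (p := p) (Or.inl hv.ne')).sub
    ((hasDerivAt_id s).const_mul 2)
  refine h1.congr_deriv ?_
  unfold phaseRate; ring

theorem hasDerivAt_phaseRate (P : RegularProfile p m c₀ μ a v d) (hp : 0 < p) (ha : 0 < a)
    {s : ℝ} (hs : s ∈ Icc a 1) :
    HasDerivAt (fun s => phaseRate p (v s) (d s))
      (p * (p - 1) * v s ^ (p - 2) * d s ^ 2 - μ ^ p * bubbleDensity p m c₀ μ (v s) s) s := by
  have hv : 0 < v s := lt_of_lt_of_le (by positivity) (P.lower s hs)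
  have h1 := ((((P.hasDerivAt s hs).rpow_const (p := p - 1) (Or.inl hv.ne')).const_mul p).mul
    (P.hasDerivAt_deriv s hs)).sub_const 2
  refine h1.congr_deriv ?_
  have := Real.rpow_pos_of_pos hv (p - 1)
  rw [show p - 1 - 1 = p - 2 by ring]
  field_simp
  ring

theorem hasDerivAt_bubbleDensity (P : RegularProfile p m c₀ μ a v d) (ha : 0 < a)
    {s : ℝ} (hs : s ∈ Icc a 1) :
    HasDerivAt (fun s => bubbleDensity p m c₀ μ (v s) s)
      ((m + p - 1) * (d s / v s) * bubbleDensity p m c₀ μ (v s) s +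
        μ ^ p * bubbleDensity p m c₀ μ (v s) s * phaseRate p (v s) (d s)) s := by
  have hv : 0 < v s := lt_of_lt_of_le (by positivity) (P.lower s hs)
  have h1 := ((((P.hasDerivAt s hs).rpow_const (p := m + p - 1) (Or.inl hv.ne')).const_mul
    (μ ^ (m + p - 1))).const_mul (p * c₀)).mul
    (((P.hasDerivAt_rpow_sub ha hs).const_mul (μ ^ p)).exp)
  refine h1.congr_deriv ?_
  unfold bubbleDensity
  rw [Real.rpow_sub_one hv.ne' (m + p - 1)]
  field_simp

/-- The terms ∓μ^p F γ coming from γ²/2 and from F cancel, so no large factor is left in front of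
the density. -/
theorem hasDerivAt_bubbleEnergy (P : RegularProfile p m c₀ μ a v d) (hp : 0 < p) (ha : 0 < a)
    {s : ℝ} (hs : s ∈ Icc a 1) :
    HasDerivAt (fun s => bubbleEnergy p m c₀ μ (v s) (d s) s)
      (phaseRate p (v s) (d s) * (p * (p - 1) * v s ^ (p - 2) * d s ^ 2) +
        (m + p - 1) * (d s / v s) * bubbleDensity p m c₀ μ (v s) s) s := by
  have h1 := (((P.hasDerivAt_phaseRate hp ha hs).pow 2).div_const 2).add
    (P.hasDerivAt_bubbleDensity ha hs)
  refine h1.congr_deriv ?_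
  push_cast
  ring

theorem abs_phaseRate_le (P : RegularProfile p m c₀ μ a v d) (hp : 2 < p) (ha : 0 < a)
    {s : ℝ} (hs : s ∈ Icc a 1) : |phaseRate p (v s) (d s)| ≤ p * (2 / a) + 2 := by
  have hv : 0 < v s := lt_of_lt_of_le (by positivity) (P.lower s hs)
  have h1 := Real.rpow_le_one hv.le (P.upper s hs) (show 0 ≤ p - 1 by linarith)
  have h2 := Real.rpow_pos_of_pos hv (p - 1)
  have h3 := P.deriv_nonneg s hs
  have h4 := P.deriv_le s hs
  have h5 : v s ^ (p - 1) * d s ≤ 1 * (2 / a) := mul_le_mul h1 h4 h3 zero_le_one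
  have h6 : p * (v s ^ (p - 1) * d s) ≤ p * (2 / a) :=
    mul_le_mul_of_nonneg_left (by linarith) (by linarith)
  have h7 : 0 ≤ p * (v s ^ (p - 1) * d s) := by positivity
  unfold phaseRate
  rw [abs_le]
  constructor <;> linarith

theorem convexity_term_le (P : RegularProfile p m c₀ μ a v d) (hp : 2 < p) (ha : 0 < a)
    {s : ℝ} (hs : s ∈ Icc a 1) :
    |p * (p - 1) * v s ^ (p - 2) * d s ^ 2| ≤ p * (p - 1) * (2 / a) ^ 2 := by
  have hv : 0 < v s := lt_of_lt_of_le (by positivity) (P.lower s hs)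
  have h1 := Real.rpow_le_one hv.le (P.upper s hs) (show 0 ≤ p - 2 by linarith)
  have h2 := Real.rpow_pos_of_pos hv (p - 2)
  have h3 := P.deriv_nonneg s hs
  have h4 := P.deriv_le s hs
  have h5 : v s ^ (p - 2) * d s ^ 2 ≤ 1 * (2 / a) ^ 2 :=
    mul_le_mul h1 (by gcongr) (by positivity) zero_le_one
  have hp1 : 0 < p * (p - 1) := by nlinarith
  rw [abs_of_nonneg (by positivity), mul_assoc]
  exact mul_le_mul_of_nonneg_left (by linarith) hp1.le

/-- While |γ| ≤ G, energy at least G² forces F ≥ G²/2, and the term -μ^p F then drives γ down faster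
than 2G/η. So γ crosses [-G, G] within length η and cannot come back. -/
theorem phaseRate_le_neg (P : RegularProfile p m c₀ μ a v d) (hp : 2 < p) (ha : 0 < a)
    {G η x y : ℝ} (hG : 0 < G) (hη : 0 < η)
    (hμ : p * (p - 1) * (2 / a) ^ 2 + 2 * G / η < μ ^ p * (G ^ 2 / 2))
    (hax : a ≤ x) (hy : y ≤ 1)
    (hE : ∀ s ∈ Icc x y, G ^ 2 ≤ bubbleEnergy p m c₀ μ (v s) (d s) s)
    (hx : phaseRate p (v x) (d x) ≤ G) {s : ℝ} (hs : s ∈ Icc (x + η) y) :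
    phaseRate p (v s) (d s) ≤ -G := by
  have hsub : ∀ t ∈ Icc x y, t ∈ Icc a 1 := fun t ht => ⟨hax.trans ht.1, ht.2.trans hy⟩
  refine le_neg_of_steep (γ := fun s => phaseRate p (v s) (d s)) hG hη
    (fun t ht => P.hasDerivAt_phaseRate (by linarith) ha (hsub t ht)) (fun t ht habs => ?_) hx hs
  have h1 := (abs_le.1 (P.convexity_term_le hp ha (hsub t ht))).2
  have h2 := hE t ht
  unfold bubbleEnergy at h2
  have h3 : phaseRate p (v t) (d t) ^ 2 ≤ G ^ 2 := sq_le_sq' (abs_le.1 habs).1 (abs_le.1 habs).2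
  have h4 : G ^ 2 / 2 ≤ bubbleDensity p m c₀ μ (v t) t := by linarith
  have h5 := mul_le_mul_of_nonneg_left h4 (Real.rpow_pos_of_pos P.pos p).le
  linarith

/-- Bounds on γ and d/v give |E'| ≤ C₁ (1 + E). Grönwall, started at s = 1 where F ≤ 1, bounds E and
hence E' independently of μ. -/
theorem abs_bubbleEnergy_sub_le (P : RegularProfile p m c₀ μ a v d) (hp : 2 < p) (ha : 0 < a)
    (hc : 0 < c₀) {C₁ : ℝ}
    (hC : (p * (2 / a) + 2) * (p * (p - 1) * (2 / a) ^ 2) + |m + p - 1| * (2 / a / (a / 4)) ≤ C₁)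
    (h1 : a ≤ 1) (hF : bubbleDensity p m c₀ μ (v 1) 1 ≤ 1)
    {x y : ℝ} (hx : x ∈ Icc a 1) (hy : y ∈ Icc a 1) :
    |bubbleEnergy p m c₀ μ (v y) (d y) y - bubbleEnergy p m c₀ μ (v x) (d x) x| ≤
      C₁ * ((2 + (p * (2 / a) + 2) ^ 2) * Real.exp C₁) * |y - x| := by
  set E := fun s => bubbleEnergy p m c₀ μ (v s) (d s) s with hEdef
  set E' := fun s => phaseRate p (v s) (d s) * (p * (p - 1) * v s ^ (p - 2) * d s ^ 2) +
        (m + p - 1) * (d s / v s) * bubbleDensity p m c₀ μ (v s) s with hE'def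
  have hder : ∀ s ∈ Icc a 1, HasDerivAt E (E' s) s := fun s hs =>
    P.hasDerivAt_bubbleEnergy (by linarith) ha hs
  have hC0 : 0 ≤ (p * (2 / a) + 2) * (p * (p - 1) * (2 / a) ^ 2) := by
    have : 0 < p * (p - 1) := by nlinarith
    positivity
  have hC0' : 0 ≤ |m + p - 1| * (2 / a / (a / 4)) := by positivity
  have hC1 : 0 ≤ C₁ := by linarith
  have hvpos : ∀ s ∈ Icc a 1, 0 < v s := fun s hs =>
    lt_of_lt_of_le (by positivity) (P.lower s hs)
  have hFpos : ∀ s ∈ Icc a 1, 0 < bubbleDensity p m c₀ μ (v s) s := fun s hs =>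
    bubbleDensity_pos s (by linarith) hc P.pos (hvpos s hs)
  have hE0 : ∀ s ∈ Icc a 1, 0 ≤ E s := fun s hs => by
    have := hFpos s hs
    simp only [hEdef, bubbleEnergy]
    positivity
  have hE'le : ∀ s ∈ Icc a 1, |E' s| ≤ C₁ * (1 + E s) := by
    intro s hs
    have hF0 := hFpos s hs
    have hFE : bubbleDensity p m c₀ μ (v s) s ≤ E s := by
      simp only [hEdef, bubbleEnergy]
      nlinarith [sq_nonneg (phaseRate p (v s) (d s))]
    have e1 : |phaseRate p (v s) (d s) * (p * (p - 1) * v s ^ (p - 2) * d s ^ 2)| ≤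
        (p * (2 / a) + 2) * (p * (p - 1) * (2 / a) ^ 2) := by
      rw [abs_mul]
      exact mul_le_mul (P.abs_phaseRate_le hp ha hs) (P.convexity_term_le hp ha hs)
        (abs_nonneg _) (by positivity)
    have e2 : |(m + p - 1) * (d s / v s) * bubbleDensity p m c₀ μ (v s) s| ≤
        |m + p - 1| * (2 / a / (a / 4)) * E s := by
      rw [abs_mul, abs_mul, abs_of_pos hF0, abs_of_nonneg
        (div_nonneg (P.deriv_nonneg s hs) (hvpos s hs).le)]
      have : d s / v s ≤ 2 / a / (a / 4) :=
        div_le_div₀ (by positivity) (P.deriv_le s hs) (by positivity) (P.lower s hs)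
      gcongr
    have e3 := abs_add_le (phaseRate p (v s) (d s) * (p * (p - 1) * v s ^ (p - 2) * d s ^ 2))
      ((m + p - 1) * (d s / v s) * bubbleDensity p m c₀ μ (v s) s)
    have e4 := hE0 s hs
    have e5 : (p * (2 / a) + 2) * (p * (p - 1) * (2 / a) ^ 2) ≤ C₁ := by linarith
    have e6 : |m + p - 1| * (2 / a / (a / 4)) * E s ≤ C₁ * E s :=
      mul_le_mul_of_nonneg_right (by linarith) e4
    simp only [hE'def]
    linarith
  have hE1 : E 1 ≤ (p * (2 / a) + 2) ^ 2 + 1 := by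
    have h2 := P.abs_phaseRate_le hp ha (right_mem_Icc.2 h1)
    have h3 : phaseRate p (v 1) (d 1) ^ 2 ≤ (p * (2 / a) + 2) ^ 2 :=
      sq_le_sq' (abs_le.1 h2).1 (abs_le.1 h2).2
    simp only [hEdef, bubbleEnergy]
    nlinarith [sq_nonneg (phaseRate p (v 1) (d 1))]
  -- Grönwall backwards from 1: the weight compensates E' ≥ -C₁ (1 + E).
  have hmono : MonotoneOn (fun s => (1 + E s) * Real.exp (C₁ * s)) (Icc a 1) := by
    have hd : ∀ s ∈ Icc a 1, HasDerivAt (fun s => (1 + E s) * Real.exp (C₁ * s))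
        ((E' s + C₁ * (1 + E s)) * Real.exp (C₁ * s)) s := by
      intro s hs
      have := ((hder s hs).const_add 1).mul (((hasDerivAt_id s).const_mul C₁).exp)
      refine this.congr_deriv ?_
      simp only [id]; ring
    refine monotoneOn_of_deriv_nonneg (convex_Icc a 1)
      (fun s hs => (hd s hs).continuousAt.continuousWithinAt) ?_ ?_
    · intro s hs
      exact (hd s (interior_subset hs)).differentiableAt.differentiableWithinAt
    · intro s hs
      rw [(hd s (interior_subset hs)).deriv]
      have := (abs_le.1 (hE'le s (interior_subset hs))).1
      exact mul_nonneg (by linarith) (Real.exp_pos _).le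
  have hEle : ∀ s ∈ Icc a 1, 1 + E s ≤ (2 + (p * (2 / a) + 2) ^ 2) * Real.exp C₁ := by
    intro s hs
    have h2 := hmono hs (right_mem_Icc.2 h1) hs.2
    simp only [mul_one] at h2
    have h3 : (1 : ℝ) ≤ Real.exp (C₁ * s) :=
      Real.one_le_exp (mul_nonneg hC1 (ha.le.trans hs.1))
    have h4 := hE0 s hs
    calc 1 + E s ≤ (1 + E s) * Real.exp (C₁ * s) := le_mul_of_one_le_right (by linarith) h3
      _ ≤ (1 + E 1) * Real.exp C₁ := h2
      _ ≤ _ := mul_le_mul_of_nonneg_right (by linarith) (Real.exp_pos _).le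
  have := Convex.norm_image_sub_le_of_norm_hasDerivWithin_le (f := E) (f' := E')
    (fun s hs => (hder s hs).hasDerivWithinAt)
    (C := C₁ * ((2 + (p * (2 / a) + 2) ^ 2) * Real.exp C₁))
    (fun s hs => (hE'le s hs).trans (mul_le_mul_of_nonneg_left (hEle s hs) hC1))
    (convex_Icc a 1) hx hy
  simpa [Real.norm_eq_abs] using this

end RegularProfile

end

/-! ### Uniform estimates along a blow-up family -/

noncomputable section

/-- A family of profiles with `μ n → ∞` whose domains exhaust `(0, ∞)`, for a nonlinearity
which agrees with `c₀ * t ^ m * exp (t ^ p)` for `t ≥ τ₀`. -/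
structure BlowUpFamily {ι : Type*} (f : ℝ → ℝ) (p m c₀ τ₀ : ℝ) (l : Filter ι) (μ s₀ : ι → ℝ)
    (v d : ι → ℝ → ℝ) : Prop where
  two_lt : 2 < p
  coeff_pos : 0 < c₀
  threshold_pos : 0 < τ₀
  nonneg : ∀ t, 0 ≤ t → 0 ≤ f t
  eq_model : ∀ t, τ₀ ≤ t → f t = c₀ * t ^ m * Real.exp (t ^ p)
  bounded : ∃ C, ∀ t ∈ Icc 0 τ₀, f t ≤ C
  tendsto_height : Tendsto μ l atTop
  eventually_start_lt : ∀ a, 0 < a → ∀ᶠ n in l, s₀ n < a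
  profile : ∀ᶠ n in l, LogProfile f p (μ n) (s₀ n) (v n) (d n)

namespace BlowUpFamily

variable {ι : Type*} {f : ℝ → ℝ} {p m c₀ τ₀ : ℝ} {l : Filter ι} {μ s₀ : ι → ℝ} {v d : ι → ℝ → ℝ}

/-- On [0, μ] the nonlinearity is at most a constant plus powers of μ times exp(μ^p). The factor
exp(-2 μ^p s) in `one_sub_le` beats this because s > 1/2. -/
theorem tendsto_one (B : BlowUpFamily f p m c₀ τ₀ l μ s₀ v d) {s : ℝ} (hs : 1 / 2 < s) :
    Tendsto (fun n => v n s) l (𝓝 1) := by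
  obtain ⟨C, hC⟩ := B.bounded
  have hp : 0 < p := by linarith [B.two_lt]
  have hC0 : 0 ≤ C := (B.nonneg 0 le_rfl).trans (hC 0 ⟨le_rfl, B.threshold_pos.le⟩)
  have t1 := (tendsto_rpow_mul_exp_neg B.tendsto_height hp
    (show 0 < 2 * s by linarith) (-1)).const_mul (C / 4)
  have t2 := (tendsto_rpow_mul_exp_neg B.tendsto_height hp
    (show 0 < 2 * s - 1 by linarith) (-1)).const_mul (c₀ * τ₀ ^ m / 4)
  have t3 := (tendsto_rpow_mul_exp_neg B.tendsto_height hp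
    (show 0 < 2 * s - 1 by linarith) (m - 1)).const_mul (c₀ / 4)
  have t4 := ((t1.add t2).add t3).const_sub 1
  simp only [mul_zero, add_zero, sub_zero] at t4
  refine tendsto_of_tendsto_of_tendsto_of_le_of_le' t4 tendsto_const_nhds ?_ ?_
  · filter_upwards [B.profile, B.tendsto_height.eventually_gt_atTop 0,
      B.tendsto_height.eventually_ge_atTop τ₀, B.eventually_start_lt s (by linarith)]
      with n P hμ hμτ hst
    -- The sum τ₀^m + μ^m bounds t^m on [τ₀, μ] for either sign of m.
    have hM : ∀ t, 0 ≤ t → t ≤ μ n →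
        f t ≤ C + c₀ * (τ₀ ^ m + μ n ^ m) * Real.exp (μ n ^ p) := by
      intro t ht0 ht
      have q1 := Real.rpow_pos_of_pos B.threshold_pos m
      have q2 := Real.rpow_pos_of_pos hμ m
      have := B.coeff_pos
      rcases le_total t τ₀ with h | h
      · have : 0 < c₀ * (τ₀ ^ m + μ n ^ m) * Real.exp (μ n ^ p) := by positivity
        linarith [hC t ⟨ht0, h⟩]
      · rw [B.eq_model t h]
        have q3 : t ^ m ≤ τ₀ ^ m + μ n ^ m := by
          rcases le_total 0 m with hm | hm
          · linarith [Real.rpow_le_rpow ht0 ht hm]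
          · linarith [Real.rpow_le_rpow_of_nonpos B.threshold_pos h hm]
        have q4 : Real.exp (t ^ p) ≤ Real.exp (μ n ^ p) :=
          Real.exp_le_exp.2 (Real.rpow_le_rpow ht0 ht hp.le)
        have : c₀ * t ^ m * Real.exp (t ^ p) ≤ c₀ * (τ₀ ^ m + μ n ^ m) * Real.exp (μ n ^ p) := by
          gcongr
        linarith
    have h1 := P.one_sub_le hμ B.nonneg hM hst
    refine le_trans (le_of_eq ?_) h1
    have e1 : Real.exp (-(2 * s - 1) * μ n ^ p) =
        Real.exp (μ n ^ p) * Real.exp (-(2 * μ n ^ p * s)) := by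
      rw [← Real.exp_add]; congr 1; ring
    have e2 : Real.exp (-(2 * s) * μ n ^ p) = Real.exp (-(2 * μ n ^ p * s)) := by
      congr 1; ring
    rw [e1, e2, Real.rpow_neg_one, Real.rpow_sub_one hμ.ne']
    field_simp
    ring
  · filter_upwards [B.profile, B.tendsto_height.eventually_gt_atTop 0,
      B.eventually_start_lt s (by linarith)] with n P hμ hst
    exact P.le_one hμ B.nonneg hst

/-- The lower bound a/4 on `v` gives μ v ≥ τ₀ on [a, 1] for large μ, so only the model form of `f`
matters there. -/
theorem eventually_regular (B : BlowUpFamily f p m c₀ τ₀ l μ s₀ v d) {a : ℝ} (ha : 0 < a) :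
    ∀ᶠ n in l, RegularProfile p m c₀ (μ n) a (v n) (d n) := by
  filter_upwards [B.profile, B.tendsto_height.eventually_gt_atTop 0,
    B.tendsto_height.eventually_ge_atTop (τ₀ / (a / 4)), B.eventually_start_lt (a / 2) (by linarith),
    (B.tendsto_one (s := 1) (by norm_num)).eventually (lt_mem_nhds (show 1 / 2 < (1 : ℝ) by norm_num))]
    with n P hμ hμτ hst h1
  have hlow : ∀ s ∈ Icc a 1, a / 4 ≤ v n s := by
    intro s hs
    have := P.half_mul_le hμ B.nonneg ha hst hs.1 hs.2
    nlinarith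
  have hst' : ∀ s ∈ Icc a 1, s₀ n < s := fun s hs => by linarith [hs.1]
  refine ⟨hμ, hlow, fun s hs => P.le_one hμ B.nonneg (hst' s hs),
    fun s hs => P.deriv_nonneg hμ B.nonneg (hst' s hs),
    fun s hs => P.deriv_le hμ B.nonneg ha hst hs.1,
    (P.monotoneOn hμ B.nonneg).mono fun s hs => hst' s hs,
    fun x hx y hy => P.le_add_mul hμ B.nonneg (hst' x hx) (hst' y hy),
    fun s hs => P.hasDerivAt s (hst' s hs), fun s hs => ?_⟩
  refine (P.hasDerivAt_deriv s (hst' s hs)).congr_deriv ?_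
  have hv : 0 < v n s := P.pos s (hst' s hs)
  have hτ : τ₀ ≤ μ n * v n s := by
    rw [div_le_iff₀ (by linarith)] at hμτ
    exact hμτ.trans (mul_le_mul_of_nonneg_left (hlow s hs) hμ.le)
  rw [B.eq_model _ hτ, Real.mul_rpow hμ.le hv.le, Real.mul_rpow hμ.le hv.le]
  unfold bubbleDensity
  have e1 : Real.exp (μ n ^ p * (v n s ^ p - 2 * s)) =
      Real.exp (-(2 * μ n ^ p * s)) * Real.exp (μ n ^ p * v n s ^ p) := by
    rw [← Real.exp_add]; congr 1; ring
  have e2 : v n s ^ (m + p - 1) = v n s ^ m * v n s ^ (p - 1) := by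
    rw [← Real.rpow_add hv]; congr 1; ring
  have e3 : μ n ^ (2 * p - 1) * μ n ^ m = μ n ^ p * μ n ^ (m + p - 1) := by
    rw [← Real.rpow_add hμ, ← Real.rpow_add hμ]; congr 1; ring
  have := Real.rpow_pos_of_pos hv (p - 1)
  have hp : 0 < p := by linarith [B.two_lt]
  rw [e1, e2]
  field_simp
  linear_combination (-c₀) * e3

theorem eventually_density_le (B : BlowUpFamily f p m c₀ τ₀ l μ s₀ v d) {a η c : ℝ} (ha : 0 < a)
    (hη : 0 < η) (hc : 0 < c) : ∀ᶠ n in l, ∀ s ∈ Icc a 1, v n s ^ p - 2 * s ≤ -η →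
      bubbleDensity p m c₀ (μ n) (v n s) s ≤ c ∧
      μ n ^ p * bubbleDensity p m c₀ (μ n) (v n s) s ≤ c := by
  obtain ⟨κ, K, hκ, hK, hb⟩ := exists_rpow_bounds (m + p - 1) (show 0 < a / 4 by linarith)
  have hp : 0 < p := by linarith [B.two_lt]
  have hc₀ := B.coeff_pos
  have t := (tendsto_rpow_mul_exp_neg B.tendsto_height hp hη (m + p - 1 + p)).const_mul (p * c₀ * K)
  rw [mul_zero] at t
  filter_upwards [B.eventually_regular ha, B.tendsto_height.eventually_ge_atTop 1,
    t.eventually (gt_mem_nhds hc)] with n P hμ1 ht s hs hz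
  have hμ := P.pos
  have hv : 0 < v n s := lt_of_lt_of_le (by positivity) (P.lower s hs)
  have hk := (hb _ (P.lower s hs) (P.upper s hs)).2
  have hΛ := Real.rpow_pos_of_pos hμ p
  have hexp : Real.exp (μ n ^ p * (v n s ^ p - 2 * s)) ≤ Real.exp (-η * μ n ^ p) := by
    apply Real.exp_le_exp.2
    nlinarith
  have hμk := Real.rpow_pos_of_pos hμ (m + p - 1)
  have hΛ1 : 1 ≤ μ n ^ p := Real.one_le_rpow hμ1 hp.le
  have h1 : bubbleDensity p m c₀ (μ n) (v n s) s ≤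
      p * c₀ * (μ n ^ (m + p - 1) * K) * Real.exp (-η * μ n ^ p) := by
    unfold bubbleDensity
    gcongr
  have h2 : μ n ^ p * bubbleDensity p m c₀ (μ n) (v n s) s ≤ c := by
    refine (mul_le_mul_of_nonneg_left h1 hΛ.le).trans (le_of_eq ?_ |>.trans ht.le)
    rw [Real.rpow_add hμ]
    ring
  have h3 := bubbleDensity_pos (m := m) s hp hc₀ hμ hv
  exact ⟨le_trans (le_mul_of_one_le_left h3.le hΛ1) h2, h2⟩

theorem exists_energy_lipschitz (B : BlowUpFamily f p m c₀ τ₀ l μ s₀ v d) {a : ℝ} (ha : 0 < a)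
    (ha1 : a ≤ 1) : ∃ C, 0 < C ∧ ∀ᶠ n in l, ∀ x ∈ Icc a 1, ∀ y ∈ Icc a 1,
      |bubbleEnergy p m c₀ (μ n) (v n y) (d n y) y - bubbleEnergy p m c₀ (μ n) (v n x) (d n x) x|
        ≤ C * |y - x| := by
  have hp := B.two_lt
  obtain ⟨C₁, hC₁⟩ : ∃ C₁, C₁ = (p * (2 / a) + 2) * (p * (p - 1) * (2 / a) ^ 2) +
    |m + p - 1| * (2 / a / (a / 4)) := ⟨_, rfl⟩
  have hpos : 0 < C₁ := by
    rw [hC₁]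
    have : 0 < p * (p - 1) := by nlinarith
    positivity
  refine ⟨C₁ * ((2 + (p * (2 / a) + 2) ^ 2) * Real.exp C₁), by positivity, ?_⟩
  filter_upwards [B.eventually_regular ha,
    B.eventually_density_le ha one_pos one_pos] with n P hF x hx y hy
  refine P.abs_bubbleEnergy_sub_le hp ha B.coeff_pos hC₁.ge ha1 ?_ hx hy
  have h1 := right_mem_Icc.2 ha1
  refine (hF 1 h1 ?_).1
  have h2 : 0 < v n 1 := lt_of_lt_of_le (by positivity) (P.lower 1 h1)
  have := Real.rpow_le_one h2.le (P.upper 1 h1) (show 0 ≤ p by linarith)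
  linarith

/-- If the excess over the critical curve is above η at `s`, monotonicity of `v` keeps it above η/2
on a short interval to the right. There d' is negative and exponentially large, which contradicts 0
≤ d ≤ 2/s. -/
theorem eventually_rpow_sub_le (B : BlowUpFamily f p m c₀ τ₀ l μ s₀ v d) {s η : ℝ} (hs : 0 < s)
    (hs1 : s ≤ 1) (hη : 0 < η) : ∀ᶠ n in l, v n s ^ p - 2 * s ≤ η := by
  obtain ⟨κ, K, hκ, hK, hb⟩ := exists_rpow_bounds m (show 0 < s / 4 by linarith)
  have hp : 0 < p := by linarith [B.two_lt]
  have hc₀ := B.coeff_pos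
  -- The first entry limits the growth of 2t to η/2; the second keeps `s + δ ≤ 1`, since v ≤ 1
  -- forces s ≤ 1/2.
  set δ := min (η / 4) (1 / 2) with hδ
  have hδ0 : 0 < δ := lt_min (by linarith) (by norm_num)
  have hδη : δ ≤ η / 4 := min_le_left _ _
  have hδ2 : δ ≤ 1 / 2 := min_le_right _ _
  have t := tendsto_rpow_mul_exp_atTop B.tendsto_height hp (half_pos hη) (p + (m + p - 1))
  filter_upwards [B.eventually_regular hs,
    t.eventually_gt_atTop (2 / s / (c₀ * κ * δ))] with n P ht
  by_contra! hz
  have hμ := P.pos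
  have hpos : ∀ t ∈ Icc s 1, 0 < v n t := fun t ht =>
    lt_of_lt_of_le (by positivity) (P.lower t ht)
  have hs' := left_mem_Icc.2 hs1
  have hsle : s ≤ 1 / 2 := by
    have := Real.rpow_le_one (hpos s hs').le (P.upper s hs') hp.le
    linarith
  have hsub : ∀ t ∈ Icc s (s + δ), t ∈ Icc s 1 := fun t ht => ⟨ht.1, by linarith [ht.2]⟩
  obtain ⟨t, htm, hslope⟩ := exists_hasDerivAt_eq_slope (d n) _ (show s < s + δ by linarith)
    (fun t ht => (P.hasDerivAt_deriv t (hsub t ht)).continuousAt.continuousWithinAt)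
    (fun t ht => P.hasDerivAt_deriv t (hsub t (Ioo_subset_Icc_self ht)))
  have htI := hsub t (Ioo_subset_Icc_self htm)
  have hvt := hpos t htI
  have hzt : η / 2 ≤ v n t ^ p - 2 * t := by
    have := Real.rpow_le_rpow (hpos s hs').le (P.monotoneOn hs' htI htI.1) hp.le
    linarith [htm.2]
  have d1 := P.deriv_le s hs'
  have d2 := P.deriv_nonneg (s + δ) (hsub _ (right_mem_Icc.2 (by linarith)))
  rw [add_sub_cancel_left, eq_div_iff hδ0.ne'] at hslope
  have hk := (hb _ (P.lower t htI) (P.upper t htI)).1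
  have e2 : v n t ^ (m + p - 1) = v n t ^ m * v n t ^ (p - 1) := by
    rw [← Real.rpow_add hvt]; congr 1; ring
  have hvp := Real.rpow_pos_of_pos hvt (p - 1)
  have hΛ := Real.rpow_pos_of_pos hμ p
  have hΛk := Real.rpow_pos_of_pos hμ (m + p - 1)
  have hF : μ n ^ p * bubbleDensity p m c₀ (μ n) (v n t) t / (p * v n t ^ (p - 1)) =
      c₀ * (μ n ^ p * μ n ^ (m + p - 1)) * v n t ^ m *
        Real.exp (μ n ^ p * (v n t ^ p - 2 * t)) := by
    unfold bubbleDensity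
    rw [e2]; field_simp
  have hexp : Real.exp (η / 2 * μ n ^ p) ≤ Real.exp (μ n ^ p * (v n t ^ p - 2 * t)) := by
    apply Real.exp_le_exp.2
    nlinarith
  have hF2 : c₀ * (μ n ^ p * μ n ^ (m + p - 1)) * κ * Real.exp (η / 2 * μ n ^ p) ≤
      μ n ^ p * bubbleDensity p m c₀ (μ n) (v n t) t / (p * v n t ^ (p - 1)) := by
    rw [hF]; gcongr
  rw [Real.rpow_add hμ, div_lt_iff₀ (by positivity)] at ht
  have h5 := mul_le_mul_of_nonneg_right hF2 hδ0.le
  nlinarith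

theorem eventually_phaseRate_le_neg (B : BlowUpFamily f p m c₀ τ₀ l μ s₀ v d) {a G η : ℝ}
    (ha : 0 < a) (hG : 0 < G) (hη : 0 < η) :
    ∀ᶠ n in l, ∀ x y, a ≤ x → y ≤ 1 →
      (∀ s ∈ Icc x y, G ^ 2 ≤ bubbleEnergy p m c₀ (μ n) (v n s) (d n s) s) →
      phaseRate p (v n x) (d n x) ≤ G → ∀ s ∈ Icc (x + η) y,
      phaseRate p (v n s) (d n s) ≤ -G := by
  have hp := B.two_lt
  have t := (((tendsto_rpow_atTop (show 0 < p by linarith)).comp B.tendsto_height).atTop_mul_const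
    (show 0 < G ^ 2 / 2 by positivity)).eventually_gt_atTop
      (p * (p - 1) * (2 / a) ^ 2 + 2 * G / η)
  filter_upwards [B.eventually_regular ha, t] with n P ht x y hx hy hE hγ s hs
  exact P.phaseRate_le_neg hp ha hG hη ht hx hy hE hγ hs

end BlowUpFamily

end

/-! ### Limit profiles -/

noncomputable section

/-- Pointwise limits `V`, `D` of a blow-up family and of its derivatives. -/
structure BlowUpLimit {ι : Type*} (f : ℝ → ℝ) (p m c₀ τ₀ : ℝ) (l : Filter ι) (μ s₀ : ι → ℝ)
    (v d : ι → ℝ → ℝ) (V D : ℝ → ℝ) : Prop where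
  family : BlowUpFamily f p m c₀ τ₀ l μ s₀ v d
  tendsto : ∀ s ∈ Ioc (0 : ℝ) 1, Tendsto (fun n => v n s) l (𝓝 (V s))
  tendsto_deriv : ∀ s ∈ Ioc (0 : ℝ) 1, Tendsto (fun n => d n s) l (𝓝 (D s))

/-- Along an ultrafilter pointwise limits always exist. -/
theorem BlowUpFamily.exists_limit {ι : Type*} {f : ℝ → ℝ} {p m c₀ τ₀ : ℝ} {l : Ultrafilter ι}
    {μ s₀ : ι → ℝ} {v d : ι → ℝ → ℝ}
    (B : BlowUpFamily f p m c₀ τ₀ (l : Filter ι) μ s₀ v d) :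
    ∃ V D : ℝ → ℝ, BlowUpLimit f p m c₀ τ₀ (l : Filter ι) μ s₀ v d V D := by
  have h : ∀ s : ℝ, ∃ x y : ℝ, s ∈ Ioc (0 : ℝ) 1 →
      Tendsto (fun n => v n s) l (𝓝 x) ∧ Tendsto (fun n => d n s) l (𝓝 y) := by
    intro s
    by_cases hs : s ∈ Ioc (0 : ℝ) 1
    · have hreg := B.eventually_regular hs.1
      have hss : s ∈ Icc s 1 := left_mem_Icc.2 hs.2
      obtain ⟨x, -, hx⟩ := (isCompact_Icc (a := s / 4) (b := 1)).ultrafilter_le_nhds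
        (l.map fun n => v n s) (by
          rw [le_principal_iff, Ultrafilter.mem_coe, Ultrafilter.mem_map, ← Ultrafilter.mem_coe]
          filter_upwards [hreg] with n P using ⟨P.lower s hss, P.upper s hss⟩)
      obtain ⟨y, -, hy⟩ := (isCompact_Icc (a := 0) (b := 2 / s)).ultrafilter_le_nhds
        (l.map fun n => d n s) (by
          rw [le_principal_iff, Ultrafilter.mem_coe, Ultrafilter.mem_map, ← Ultrafilter.mem_coe]
          filter_upwards [hreg] with n P using ⟨P.deriv_nonneg s hss, P.deriv_le s hss⟩)
      exact ⟨x, y, fun _ => ⟨hx, hy⟩⟩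
    · exact ⟨0, 0, fun h => absurd h hs⟩
  choose V D hVD using h
  exact ⟨V, D, B, fun s hs => (hVD s hs).1, fun s hs => (hVD s hs).2⟩

namespace BlowUpLimit

variable {ι : Type*} {f : ℝ → ℝ} {p m c₀ τ₀ : ℝ} {l : Filter ι} {μ s₀ : ι → ℝ} {v d : ι → ℝ → ℝ}
  {V D : ℝ → ℝ}

theorem p_pos (B : BlowUpLimit f p m c₀ τ₀ l μ s₀ v d V D) : 0 < p := by
  linarith [B.family.two_lt]

theorem pos [l.NeBot] (B : BlowUpLimit f p m c₀ τ₀ l μ s₀ v d V D) {s : ℝ}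
    (hs : s ∈ Ioc (0 : ℝ) 1) : 0 < V s := by
  have : s / 4 ≤ V s := ge_of_tendsto (B.tendsto s hs) (by
    filter_upwards [B.family.eventually_regular hs.1] with n P
    exact P.lower s (left_mem_Icc.2 hs.2))
  linarith [hs.1]

theorem le_one [l.NeBot] (B : BlowUpLimit f p m c₀ τ₀ l μ s₀ v d V D) {s : ℝ}
    (hs : s ∈ Ioc (0 : ℝ) 1) : V s ≤ 1 :=
  le_of_tendsto (B.tendsto s hs) (by
    filter_upwards [B.family.eventually_regular hs.1] with n P
    exact P.upper s (left_mem_Icc.2 hs.2))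

theorem deriv_nonneg [l.NeBot] (B : BlowUpLimit f p m c₀ τ₀ l μ s₀ v d V D) {s : ℝ}
    (hs : s ∈ Ioc (0 : ℝ) 1) : 0 ≤ D s :=
  ge_of_tendsto (B.tendsto_deriv s hs) (by
    filter_upwards [B.family.eventually_regular hs.1] with n P
    exact P.deriv_nonneg s (left_mem_Icc.2 hs.2))

theorem deriv_le [l.NeBot] (B : BlowUpLimit f p m c₀ τ₀ l μ s₀ v d V D) {a s : ℝ}
    (ha : 0 < a) (hs : s ∈ Icc a 1) : D s ≤ 2 / a :=
  le_of_tendsto (B.tendsto_deriv s ⟨ha.trans_le hs.1, hs.2⟩) (by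
    filter_upwards [B.family.eventually_regular ha] with n P
    exact P.deriv_le s hs)

theorem le_add_mul [l.NeBot] (B : BlowUpLimit f p m c₀ τ₀ l μ s₀ v d V D) {x y : ℝ}
    (hx : x ∈ Ioc (0 : ℝ) 1) (hy : y ∈ Ioc (0 : ℝ) 1) : V y ≤ V x + D x * (y - x) := by
  refine le_of_tendsto_of_tendsto (B.tendsto y hy)
    ((B.tendsto x hx).add ((B.tendsto_deriv x hx).mul_const (y - x))) ?_
  filter_upwards [B.family.eventually_regular (a := min x y) (lt_min hx.1 hy.1)] with n P
  exact P.le_add_mul x ⟨min_le_left _ _, hx.2⟩ y ⟨min_le_right _ _, hy.2⟩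

theorem rpow_le [l.NeBot] (B : BlowUpLimit f p m c₀ τ₀ l μ s₀ v d V D) {s : ℝ}
    (hs : s ∈ Ioc (0 : ℝ) 1) : V s ^ p ≤ 2 * s := by
  refine le_of_forall_pos_le_add fun η hη => ?_
  refine le_of_tendsto ((B.tendsto s hs).rpow_const (Or.inr B.p_pos.le)) ?_
  filter_upwards [B.family.eventually_rpow_sub_le hs.1 hs.2 hη] with n hn
  linarith

theorem continuousOn [l.NeBot] (B : BlowUpLimit f p m c₀ τ₀ l μ s₀ v d V D) :
    ContinuousOn V (Ioc 0 1) := by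
  intro x hx
  have hlip : LipschitzOnWith (Real.toNNReal (2 / (x / 2))) V (Icc (x / 2) 1) := by
    refine LipschitzOnWith.of_le_add_mul' _ fun y hy z hz => ?_
    have hx2 : 0 < x / 2 := half_pos hx.1
    have hy' : y ∈ Ioc (0 : ℝ) 1 := ⟨hx2.trans_le hy.1, hy.2⟩
    have hz' : z ∈ Ioc (0 : ℝ) 1 := ⟨hx2.trans_le hz.1, hz.2⟩
    have h1 := B.le_add_mul hz' hy'
    have h2 : D z * (y - z) ≤ 2 / (x / 2) * |y - z| :=
      (mul_le_mul_of_nonneg_left (le_abs_self _) (B.deriv_nonneg hz')).trans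
        (mul_le_mul_of_nonneg_right (B.deriv_le hx2 hz) (abs_nonneg _))
    rw [Real.dist_eq]
    linarith
  refine (hlip.continuousOn x ⟨by linarith [hx.1], hx.2⟩).mono_of_mem_nhdsWithin ?_
  filter_upwards [self_mem_nhdsWithin,
    mem_nhdsWithin_of_mem_nhds (lt_mem_nhds (show x / 2 < x by linarith [hx.1]))] with y hy hxy
  exact ⟨hxy.le, hy.2⟩

theorem eq_one [l.NeBot] (B : BlowUpLimit f p m c₀ τ₀ l μ s₀ v d V D) {s : ℝ}
    (hs : s ∈ Ioc (1 / 2 : ℝ) 1) : V s = 1 :=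
  tendsto_nhds_unique (B.tendsto s ⟨by linarith [hs.1], hs.2⟩) (B.family.tendsto_one hs.1)

/-- The limit equals 1 just right of 1/2, and a tangent of finite slope at 1/2 does not allow a jump
up to it. -/
theorem half_eq_one [l.NeBot] (B : BlowUpLimit f p m c₀ τ₀ l μ s₀ v d V D) : V (1 / 2) = 1 := by
  have hmem : (1 / 2 : ℝ) ∈ Ioc (0 : ℝ) 1 := by constructor <;> norm_num
  refine le_antisymm (B.le_one hmem) ?_
  by_contra! h
  have hD := B.deriv_nonneg hmem
  set e := min (1 / 2) ((1 - V (1 / 2)) / (2 * (D (1 / 2) + 1))) with he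
  have he0 : 0 < e := lt_min (by norm_num) (div_pos (by linarith) (by linarith))
  have he1 : e ≤ 1 / 2 := min_le_left _ _
  have he2 : e ≤ (1 - V (1 / 2)) / (2 * (D (1 / 2) + 1)) := min_le_right _ _
  rw [le_div_iff₀ (by linarith)] at he2
  have h1 := B.le_add_mul hmem (y := 1 / 2 + e) ⟨by linarith, by linarith⟩
  rw [B.eq_one ⟨by linarith, by linarith⟩] at h1
  nlinarith

theorem tendsto_phaseRate (B : BlowUpLimit f p m c₀ τ₀ l μ s₀ v d V D) {s : ℝ}
    (hs : s ∈ Ioc (0 : ℝ) 1) :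
    Tendsto (fun n => phaseRate p (v n s) (d n s)) l (𝓝 (phaseRate p (V s) (D s))) := by
  unfold phaseRate
  exact ((((B.tendsto s hs).rpow_const (Or.inr (by linarith [B.family.two_lt]))).const_mul p).mul
    (B.tendsto_deriv s hs)).sub_const 2

theorem tendsto_rpow_sub (B : BlowUpLimit f p m c₀ τ₀ l μ s₀ v d V D) {s : ℝ}
    (hs : s ∈ Ioc (0 : ℝ) 1) :
    Tendsto (fun n => v n s ^ p - 2 * s) l (𝓝 (V s ^ p - 2 * s)) :=
  ((B.tendsto s hs).rpow_const (Or.inr B.p_pos.le)).sub_const _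

/-- Where the limit stays below the critical curve it is locally affine. -/
theorem eventually_deriv_eq [l.NeBot] (B : BlowUpLimit f p m c₀ τ₀ l μ s₀ v d V D) {s : ℝ}
    (hs : s ∈ Ioo (0 : ℝ) 1) (hlt : V s ^ p < 2 * s) : ∀ᶠ y in 𝓝 s, D y = D s := by
  have hcont : ContinuousAt V s := B.continuousOn.continuousAt (Ioc_mem_nhds hs.1 hs.2)
  -- Comparing the value at `s + δ` with the critical curve at `s - δ` gives, as `v n` is monotone,
  -- one gap valid on the whole interval. There μ^p F tends to 0 uniformly, so the limit slope is
  -- constant.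
  have hev : ∀ᶠ δ in 𝓝[>] (0 : ℝ), V (s + δ) ^ p - 2 * (s - δ) < 0 := by
    have h1 : Tendsto (fun δ : ℝ => V (s + δ) ^ p - 2 * (s - δ)) (𝓝 0) (𝓝 (V s ^ p - 2 * s)) := by
      have h2 : Tendsto (fun δ : ℝ => s + δ) (𝓝 0) (𝓝 s) := by
        simpa using (tendsto_id (α := ℝ) (x := 𝓝 0)).const_add s
      have h3 : Tendsto (fun δ : ℝ => s - δ) (𝓝 0) (𝓝 s) := by
        simpa using (tendsto_id (α := ℝ) (x := 𝓝 0)).const_sub s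
      exact ((hcont.tendsto.comp h2).rpow_const (Or.inr B.p_pos.le)).sub (h3.const_mul 2)
    exact (h1.mono_left nhdsWithin_le_nhds).eventually (gt_mem_nhds (by linarith))
  obtain ⟨δ, hδz, hδ0, hδ1, hδ2⟩ : ∃ δ : ℝ, V (s + δ) ^ p - 2 * (s - δ) < 0 ∧ 0 < δ ∧
      δ < s / 2 ∧ δ < 1 - s := by
    have h1 := (Ioo_mem_nhdsGT (show 0 < min (s / 2) (1 - s) from
      lt_min (by linarith [hs.1]) (by linarith [hs.2])))
    obtain ⟨δ, h2, h3⟩ := (hev.and h1).exists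
    exact ⟨δ, h2, h3.1, h3.2.trans_le (min_le_left _ _), h3.2.trans_le (min_le_right _ _)⟩
  obtain ⟨η, hη, hηz⟩ : ∃ η, 0 < η ∧ V (s + δ) ^ p - 2 * (s - δ) < -η := by
    refine ⟨-(V (s + δ) ^ p - 2 * (s - δ)) / 2, by linarith, by linarith⟩
  have hδmem : s + δ ∈ Ioc (0 : ℝ) 1 := ⟨by linarith [hs.1], by linarith⟩
  have ha : 0 < s / 2 := half_pos hs.1
  have ha1 : s / 2 ≤ 1 := by linarith [hs.2]
  have hzn : ∀ᶠ n in l, v n (s + δ) ^ p - 2 * (s - δ) < -η :=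
    (((B.tendsto _ hδmem).rpow_const (Or.inr B.p_pos.le)).sub_const _).eventually
      (gt_mem_nhds hηz)
  have hp := B.p_pos
  filter_upwards [Ioo_mem_nhds (show s - δ < s by linarith) (show s < s + δ by linarith)] with y hy
  have hyI : y ∈ Ioc (0 : ℝ) 1 := ⟨by linarith [hy.1, hs.1], by linarith [hy.2]⟩
  set K := p * (s / 2 / 4) ^ (p - 1) with hK
  have hK0 : 0 < K := mul_pos hp (Real.rpow_pos_of_pos (by linarith) _)
  have hlim := ((B.tendsto_deriv y hyI).sub (B.tendsto_deriv s ⟨hs.1, hs.2.le⟩)).abs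
  have hle : |D y - D s| ≤ 0 := by
    refine le_of_forall_pos_le_add fun ε hε => ?_
    rw [zero_add]
    refine le_of_tendsto hlim ?_
    filter_upwards [B.family.eventually_regular ha, hzn,
      B.family.eventually_density_le ha hη (mul_pos hε hK0)] with n P hz hF
    have hsub : ∀ t ∈ Icc (s - δ) (s + δ), t ∈ Icc (s / 2) 1 := fun t ht =>
      ⟨by linarith [ht.1], by linarith [ht.2]⟩
    have hbound : ∀ t ∈ Icc (s - δ) (s + δ),
        ‖-(μ n ^ p * bubbleDensity p m c₀ (μ n) (v n t) t / (p * v n t ^ (p - 1)))‖ ≤ ε := by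
      intro t ht
      have htI := hsub t ht
      have hvt : 0 < v n t := lt_of_lt_of_le (by linarith) (P.lower t htI)
      have h1 : v n t ^ p ≤ v n (s + δ) ^ p := Real.rpow_le_rpow hvt.le
        (P.monotoneOn htI (hsub _ (right_mem_Icc.2 (by linarith))) ht.2) hp.le
      have h2 := (hF t htI (by linarith [ht.1])).2
      have h3 := bubbleDensity_pos (m := m) t hp B.family.coeff_pos P.pos hvt
      have h4 : K ≤ p * v n t ^ (p - 1) := mul_le_mul_of_nonneg_left
        (Real.rpow_le_rpow (by linarith) (P.lower t htI) (by linarith [B.family.two_lt])) hp.le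
      have h5 := Real.rpow_pos_of_pos P.pos p
      have h6 : 0 < p * v n t ^ (p - 1) := hK0.trans_le h4
      rw [norm_neg, Real.norm_eq_abs, abs_of_pos (by positivity), div_le_iff₀ h6]
      exact h2.trans (mul_le_mul_of_nonneg_left h4 hε.le)
    have := Convex.norm_image_sub_le_of_norm_hasDerivWithin_le
      (fun t ht => (P.hasDerivAt_deriv t (hsub t ht)).hasDerivWithinAt) hbound
      (convex_Icc _ _) (x := s) (y := y) ⟨by linarith, by linarith⟩ (Ioo_subset_Icc_self hy)
    simp only [Real.norm_eq_abs] at this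
    refine this.trans ?_
    have : |y - s| ≤ 1 := abs_le.2 ⟨by linarith [hy.1, hs.1], by linarith [hy.2]⟩
    nlinarith
  linarith [abs_nonpos_iff.1 hle]

/-- `D` is locally constant, hence constant on the interval; the tangent inequalities in both
directions make `V` affine, and continuity adds the end points. The case `x = 0` is needed later,
hence the positivity conditions on `s` and `t`. -/
theorem exists_affine [l.NeBot] (B : BlowUpLimit f p m c₀ τ₀ l μ s₀ v d V D) {x y : ℝ}
    (hx : 0 ≤ x) (hxy : x < y) (hy : y ≤ 1) (hlt : ∀ s ∈ Ioo x y, V s ^ p < 2 * s) :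
    ∃ a, 0 ≤ a ∧ (∀ s ∈ Ioo x y, D s = a) ∧
      ∀ s ∈ Icc x y, ∀ t ∈ Icc x y, 0 < s → 0 < t → V t = V s + a * (t - s) := by
  have hsub : ∀ s ∈ Ioo x y, s ∈ Ioo (0 : ℝ) 1 := fun s hs =>
    ⟨hx.trans_lt hs.1, hs.2.trans_le hy⟩
  have hder : ∀ s ∈ Ioo x y, HasDerivAt D 0 s := fun s hs =>
    (hasDerivAt_const s (D s)).congr_of_eventuallyEq (B.eventually_deriv_eq (hsub s hs) (hlt s hs))
  have hmid : (x + y) / 2 ∈ Ioo x y := ⟨by linarith, by linarith⟩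
  have hconst : ∀ s ∈ Ioo x y, D s = D ((x + y) / 2) := fun s hs =>
    isOpen_Ioo.is_const_of_deriv_eq_zero isPreconnected_Ioo
      (fun t ht => (hder t ht).differentiableAt.differentiableWithinAt)
      (fun t ht => (hder t ht).deriv) hs hmid
  refine ⟨D ((x + y) / 2), B.deriv_nonneg (Ioo_subset_Ioc_self (hsub _ hmid)), hconst, ?_⟩
  set a := D ((x + y) / 2)
  have hopen : ∀ s ∈ Ioo x y, ∀ t ∈ Ioo x y, V t - a * t = V s - a * s := by
    intro s hs t ht
    have h1 := B.le_add_mul (Ioo_subset_Ioc_self (hsub s hs)) (Ioo_subset_Ioc_self (hsub t ht))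
    have h2 := B.le_add_mul (Ioo_subset_Ioc_self (hsub t ht)) (Ioo_subset_Ioc_self (hsub s hs))
    rw [hconst s hs] at h1
    rw [hconst t ht] at h2
    linarith
  have hmidI := Ioo_subset_Icc_self hmid
  have hall : ∀ t ∈ Icc x y, 0 < t → V t - a * t = V ((x + y) / 2) - a * ((x + y) / 2) := by
    intro t ht ht0
    have hcl : t ∈ closure (Ioo x y) := by rwa [closure_Ioo hxy.ne]
    have := mem_closure_iff_nhdsWithin_neBot.1 hcl
    have h1 : Tendsto (fun t => V t - a * t) (𝓝[Ioo x y] t) (𝓝 (V t - a * t)) := by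
      have hsub' : Ioo x y ⊆ Ioc 0 1 := fun s hs => Ioo_subset_Ioc_self (hsub s hs)
      have h2 : ContinuousWithinAt V (Ioc 0 1) t := B.continuousOn t ⟨ht0, ht.2.trans hy⟩
      exact (h2.mono hsub').tendsto.sub
        ((tendsto_id.mono_left nhdsWithin_le_nhds).const_mul a)
    refine tendsto_nhds_unique h1 (tendsto_const_nhds.congr' ?_)
    filter_upwards [self_mem_nhdsWithin] with s hs
    exact hopen s hs _ hmid |>.symm ▸ (hopen _ hmid s hs).symm
  intro s hs t ht hs0 ht0
  have := hall s hs hs0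
  have := hall t ht ht0
  linarith

/-- Where the limit stays below the critical curve the energies converge to the kinetic part. -/
theorem tendsto_energy (B : BlowUpLimit f p m c₀ τ₀ l μ s₀ v d V D) {s : ℝ}
    (hs : s ∈ Ioc (0 : ℝ) 1) (hlt : V s ^ p < 2 * s) :
    Tendsto (fun n => bubbleEnergy p m c₀ (μ n) (v n s) (d n s) s) l
      (𝓝 (phaseRate p (V s) (D s) ^ 2 / 2)) := by
  obtain ⟨η, hη, hηz⟩ : ∃ η, 0 < η ∧ V s ^ p - 2 * s < -η :=
    ⟨-(V s ^ p - 2 * s) / 2, by linarith, by linarith⟩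
  have h1 := ((B.tendsto_phaseRate hs).pow 2).div_const 2
  have h2 : Tendsto (fun n => bubbleDensity p m c₀ (μ n) (v n s) s) l (𝓝 0) := by
    refine tendsto_order.2 ⟨fun c hc => ?_, fun c hc => ?_⟩
    · filter_upwards [B.family.eventually_regular hs.1] with n P
      refine hc.trans (bubbleDensity_pos (m := m) s B.p_pos B.family.coeff_pos P.pos ?_)
      exact lt_of_lt_of_le (by linarith [hs.1]) (P.lower s (left_mem_Icc.2 hs.2))
    · filter_upwards [B.family.eventually_density_le hs.1 hη (half_pos hc),
        (B.tendsto_rpow_sub hs).eventually (gt_mem_nhds hηz)] with n h3 h4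
      have := (h3 s (left_mem_Icc.2 hs.2) h4.le).1
      linarith
  simpa [bubbleEnergy] using h1.add h2

/-- Off the critical curve F disappears in the limit, so the Lipschitz bound for E passes to γ²/2,
even across contacts: this is the reflection law. The second part carries an energy bound from one
point off the curve to the contact itself. -/
theorem exists_energy_lower [l.NeBot] (B : BlowUpLimit f p m c₀ τ₀ l μ s₀ v d V D) {a : ℝ}
    (ha : 0 < a) (ha1 : a ≤ 1) : ∃ C, 0 < C ∧ (∀ x ∈ Icc a 1, ∀ y ∈ Icc a 1, V x ^ p < 2 * x →
      V y ^ p < 2 * y →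
      |phaseRate p (V y) (D y) ^ 2 / 2 - phaseRate p (V x) (D x) ^ 2 / 2| ≤ C * |y - x|) ∧
      ∀ x ∈ Icc a 1, V x ^ p < 2 * x → ∀ ε > 0, ∀ᶠ n in l, ∀ s ∈ Icc a 1,
        phaseRate p (V x) (D x) ^ 2 / 2 - ε - C * |s - x| ≤
          bubbleEnergy p m c₀ (μ n) (v n s) (d n s) s := by
  obtain ⟨C, hC, hlip⟩ := B.family.exists_energy_lipschitz ha ha1
  have hmem : ∀ x ∈ Icc a 1, x ∈ Ioc (0 : ℝ) 1 := fun x hx => ⟨ha.trans_le hx.1, hx.2⟩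
  refine ⟨C, hC, fun x hx y hy hzx hzy => ?_, fun x hx hz ε hε => ?_⟩
  · refine le_of_tendsto ((B.tendsto_energy (hmem y hy) hzy).sub
      (B.tendsto_energy (hmem x hx) hzx)).abs ?_
    filter_upwards [hlip] with n hn using hn x hx y hy
  · filter_upwards [hlip, (B.tendsto_energy (hmem x hx) hz).eventually
      (lt_mem_nhds (sub_lt_self _ hε))] with n hn h1 s hs
    have := (abs_le.1 (hn x hx s hs)).1
    linarith

end BlowUpLimit

end

/-! ### Contacts with the critical curve -/

noncomputable section

/-- A contact point with the critical curve `v ^ p = 2 * s` which is isolated from the right. -/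
structure IsContact (p : ℝ) (V : ℝ → ℝ) (σ : ℝ) : Prop where
  pos : 0 < σ
  le_half : σ ≤ 1 / 2
  eq : V σ ^ p = 2 * σ
  gap : ∃ δ, 0 < δ ∧ σ + δ ≤ 1 ∧ ∀ s ∈ Ioo σ (σ + δ), V s ^ p < 2 * s

namespace BlowUpLimit

variable {ι : Type*} {f : ℝ → ℝ} {p m c₀ τ₀ : ℝ} {l : Filter ι} {μ s₀ : ι → ℝ} {v d : ι → ℝ → ℝ}
  {V D : ℝ → ℝ}

theorem isContact_half [l.NeBot] (B : BlowUpLimit f p m c₀ τ₀ l μ s₀ v d V D) :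
    IsContact p V (1 / 2) := by
  refine ⟨by norm_num, le_rfl, by rw [B.half_eq_one, Real.one_rpow]; norm_num, 1 / 2, by norm_num,
    by norm_num, fun s hs => ?_⟩
  rw [B.eq_one ⟨hs.1, by linarith [hs.2]⟩, Real.one_rpow]
  linarith [hs.1]

/-- The outgoing slope at a contact point is strictly smaller than that of the critical curve. -/
theorem exists_right_slope [l.NeBot] (B : BlowUpLimit f p m c₀ τ₀ l μ s₀ v d V D) {σ : ℝ}
    (hσ : IsContact p V σ) : ∃ δ a, 0 < δ ∧ σ + δ ≤ 1 ∧ (∀ s ∈ Ioo σ (σ + δ), V s ^ p < 2 * s) ∧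
      (∀ s ∈ Ioo σ (σ + δ), D s = a) ∧ -2 ≤ phaseRate p (V σ) a ∧ phaseRate p (V σ) a < 0 := by
  obtain ⟨δ, hδ, hδ1, hgap⟩ := hσ.gap
  obtain ⟨a, ha, hD, haff⟩ := B.exists_affine hσ.pos.le (show σ < σ + δ by linarith) hδ1 hgap
  have hp := B.family.two_lt
  have hV := B.pos (s := σ) ⟨hσ.pos, by linarith⟩
  have hVp := Real.rpow_pos_of_pos hV (p - 1)
  refine ⟨δ, a, hδ, hδ1, hgap, hD, ?_, ?_⟩
  · have : 0 ≤ p * V σ ^ (p - 1) * a := by positivity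
    unfold phaseRate
    linarith
  · have hs : σ + δ / 2 ∈ Ioo σ (σ + δ) := ⟨by linarith, by linarith⟩
    have h1 := hgap _ hs
    have h2 := haff σ (left_mem_Icc.2 (by linarith)) _ (Ioo_subset_Icc_self hs) hσ.pos
      (by linarith [hσ.pos])
    -- Bernoulli: a line leaving the contact with at least the critical slope would not get below
    -- the critical curve.
    have h3 : 1 + p * (a * (δ / 2) / V σ) ≤ (1 + a * (δ / 2) / V σ) ^ p := by
      refine one_add_mul_self_le_rpow_one_add ?_ (by linarith)
      have : 0 ≤ a * (δ / 2) / V σ := by positivity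
      linarith
    have h4 : V (σ + δ / 2) = V σ * (1 + a * (δ / 2) / V σ) := by
      rw [h2]; field_simp; ring
    have h5 : V σ ^ p = V σ ^ (p - 1) * V σ := by
      rw [Real.rpow_sub_one hV.ne']; field_simp
    have h0 : 0 ≤ a * (δ / 2) / V σ := by positivity
    rw [h4, Real.mul_rpow hV.le (by linarith)] at h1
    have h6 : V σ ^ p * (1 + p * (a * (δ / 2) / V σ)) ≤
        V σ ^ p * (1 + a * (δ / 2) / V σ) ^ p :=
      mul_le_mul_of_nonneg_left h3 (Real.rpow_pos_of_pos hV p).le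
    have h7 : V σ ^ p * (1 + p * (a * (δ / 2) / V σ)) =
        V σ ^ p + p * V σ ^ (p - 1) * a * (δ / 2) := by
      rw [h5]; field_simp
    rw [h7] at h6
    have h8 : p * V σ ^ (p - 1) * a * (δ / 2) < 2 * (δ / 2) := by linarith [hσ.eq]
    have h9 := lt_of_mul_lt_mul_right h8 (by linarith)
    unfold phaseRate
    linarith

theorem tendsto_phaseRate_of_const [l.NeBot] (B : BlowUpLimit f p m c₀ τ₀ l μ s₀ v d V D) {σ a : ℝ}
    {S : Set ℝ} (hσ : σ ∈ Ioo (0 : ℝ) 1) (hD : ∀ᶠ s in 𝓝[S] σ, D s = a) :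
    Tendsto (fun s => phaseRate p (V s) (D s)) (𝓝[S] σ) (𝓝 (phaseRate p (V σ) a)) := by
  have hcont : ContinuousAt V σ := B.continuousOn.continuousAt (Ioc_mem_nhds hσ.1 hσ.2)
  have h1 : Tendsto (fun s => phaseRate p (V s) a) (𝓝[S] σ) (𝓝 (phaseRate p (V σ) a)) := by
    have h2 := (((hcont.tendsto.rpow_const (p := p - 1)
      (Or.inr (by linarith [B.family.two_lt]))).const_mul p).mul_const a).sub_const 2
    exact h2.mono_left nhdsWithin_le_nhds
  refine h1.congr' ?_
  filter_upwards [hD] with s hs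
  rw [hs]

/-- Near a contact point the energy is bounded from below, uniformly in the family. -/
theorem exists_energy_pos [l.NeBot] (B : BlowUpLimit f p m c₀ τ₀ l μ s₀ v d V D) {σ : ℝ}
    (hσ : IsContact p V σ) : ∃ G δ, 0 < G ∧ 0 < δ ∧ δ < σ ∧ σ + δ ≤ 1 ∧
      (∀ s ∈ Ioc σ (σ + δ), V s ^ p < 2 * s ∧ phaseRate p (V s) (D s) < 0) ∧
      ∀ᶠ n in l, ∀ s ∈ Icc (σ - δ) (σ + δ),
        G ^ 2 ≤ bubbleEnergy p m c₀ (μ n) (v n s) (d n s) s := by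
  obtain ⟨δ₀, a, hδ₀, hδ₁, hgap, hD, -, hneg⟩ := B.exists_right_slope hσ
  have hσ0 := hσ.pos
  have hσ1 := hσ.le_half
  have hIoo : Ioo σ (σ + δ₀) ∈ 𝓝[>] σ := Ioo_mem_nhdsGT (by linarith)
  have hlim := B.tendsto_phaseRate_of_const (S := Ioi σ) (a := a) ⟨hσ0, by linarith⟩ (by
    filter_upwards [hIoo] with s hs using hD s hs)
  obtain ⟨C, hC, -, hE⟩ := B.exists_energy_lower (half_pos hσ0) (by linarith)
  set Γ := phaseRate p (V σ) a with hΓ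
  have hev := hlim.eventually (gt_mem_nhds (show Γ < Γ / 2 by linarith))
  obtain ⟨u, hu, hsub⟩ := (mem_nhdsGT_iff_exists_Ioo_subset).1 (hev.and hIoo)
  have hu' : σ < u := hu
  -- At `σ + δ` the limit energy is at least Γ²/8. The tolerance and the Lipschitz loss 2Cδ cost at
  -- most Γ²/32 each, which leaves more than G² for G = -Γ/8.
  set δ := min (min (u - σ) σ / 2) (Γ ^ 2 / (64 * C)) with hδ
  have hΓ2 : 0 < Γ ^ 2 := by nlinarith
  have hδpos : 0 < δ := lt_min (half_pos (lt_min (by linarith) hσ0)) (by positivity)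
  have hδa : δ ≤ min (u - σ) σ / 2 := min_le_left _ _
  have hδb : δ ≤ Γ ^ 2 / (64 * C) := min_le_right _ _
  have hδc := min_le_left (u - σ) σ
  have hδd := min_le_right (u - σ) σ
  rw [le_div_iff₀ (by positivity)] at hδb
  have hprop : ∀ s ∈ Ioc σ (σ + δ), phaseRate p (V s) (D s) < Γ / 2 ∧ s ∈ Ioo σ (σ + δ₀) :=
    fun s hs => hsub ⟨hs.1, by linarith [hs.2]⟩
  have hx : σ + δ ∈ Ioc σ (σ + δ) := ⟨by linarith, le_rfl⟩
  have hx1 := (hprop _ hx).2.2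
  refine ⟨-Γ / 8, δ, by linarith, hδpos, by linarith, by linarith, fun s hs =>
    ⟨hgap s (hprop s hs).2, by linarith [(hprop s hs).1]⟩, ?_⟩
  filter_upwards [hE (σ + δ) ⟨by linarith, by linarith⟩ (hgap _ (hprop _ hx).2) (Γ ^ 2 / 32)
    (by positivity)] with n hn s hs
  have h1 := hn s ⟨by linarith [hs.1], by linarith [hs.2]⟩
  have h2 : |s - (σ + δ)| ≤ 2 * δ := abs_le.2 ⟨by linarith [hs.1], by linarith [hs.2]⟩
  have h3 : C * |s - (σ + δ)| ≤ C * (2 * δ) := mul_le_mul_of_nonneg_left h2 hC.le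
  have h4 : (Γ / 2) ^ 2 ≤ phaseRate p (V (σ + δ)) (D (σ + δ)) ^ 2 := by
    have := (hprop _ hx).1
    nlinarith
  nlinarith

/-- Near a contact point the family rises up to the contact point and falls after it. -/
theorem exists_bubble [l.NeBot] (B : BlowUpLimit f p m c₀ τ₀ l μ s₀ v d V D) {σ : ℝ}
    (hσ : IsContact p V σ) : ∃ G δ, 0 < G ∧ 0 < δ ∧ δ < σ ∧ σ + δ ≤ 1 ∧
      (∀ s ∈ Ico (σ - δ) σ, V s ^ p < 2 * s) ∧
      ∀ x ∈ Ico (σ - δ) σ, ∀ y ∈ Ioc σ (σ + δ), ∀ᶠ n in l, ∃ q ∈ Ioo x y,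
        G ^ 2 ≤ bubbleDensity p m c₀ (μ n) (v n q) q := by
  obtain ⟨G, δ, hG, hδ, hδσ, hδ1, hright, hE⟩ := B.exists_energy_pos hσ
  have hσ0 := hσ.pos
  have ha : 0 < σ - δ := by linarith
  have hmem : ∀ s ∈ Icc (σ - δ) (σ + δ), s ∈ Ioc (0 : ℝ) 1 := fun s hs =>
    ⟨by linarith [hs.1], by linarith [hs.2]⟩
  have hσm : σ ∈ Icc (σ - δ) (σ + δ) := ⟨by linarith, by linarith⟩
  have hmono : ∀ n, RegularProfile p m c₀ (μ n) (σ - δ) (v n) (d n) → ∀ x y c, σ - δ ≤ x → x < y →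
      y ≤ σ → (∀ s ∈ Icc x y, c ≤ phaseRate p (v n s) (d n s)) →
      c * (y - x) ≤ (v n y ^ p - 2 * y) - (v n x ^ p - 2 * x) := by
    intro n P x y c hx hxy hy hc
    have hI : ∀ t ∈ Icc x y, t ∈ Icc (σ - δ) 1 := fun t ht =>
      ⟨hx.trans ht.1, by linarith [ht.2]⟩
    obtain ⟨t, ht, hslope⟩ := exists_hasDerivAt_eq_slope (fun s => v n s ^ p - 2 * s) _ hxy
      (fun t ht => (P.hasDerivAt_rpow_sub ha (hI t ht)).continuousAt.continuousWithinAt)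
      (fun t ht => P.hasDerivAt_rpow_sub ha (hI t (Ioo_subset_Icc_self ht)))
    rw [eq_div_iff (by linarith)] at hslope
    rw [← hslope]
    exact mul_le_mul_of_nonneg_right (hc t (Ioo_subset_Icc_self ht)) (by linarith)
  have hmono' : ∀ n, RegularProfile p m c₀ (μ n) (σ - δ) (v n) (d n) → ∀ x y c, σ - δ ≤ x → x < y →
      y ≤ σ → (∀ s ∈ Icc x y, phaseRate p (v n s) (d n s) ≤ c) →
      (v n y ^ p - 2 * y) - (v n x ^ p - 2 * x) ≤ c * (y - x) := by
    intro n P x y c hx hxy hy hc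
    have hI : ∀ t ∈ Icc x y, t ∈ Icc (σ - δ) 1 := fun t ht =>
      ⟨hx.trans ht.1, by linarith [ht.2]⟩
    obtain ⟨t, ht, hslope⟩ := exists_hasDerivAt_eq_slope (fun s => v n s ^ p - 2 * s) _ hxy
      (fun t ht => (P.hasDerivAt_rpow_sub ha (hI t ht)).continuousAt.continuousWithinAt)
      (fun t ht => P.hasDerivAt_rpow_sub ha (hI t (Ioo_subset_Icc_self ht)))
    rw [eq_div_iff (by linarith)] at hslope
    rw [← hslope]
    exact mul_le_mul_of_nonneg_right (hc t (Ioo_subset_Icc_self ht)) (by linarith)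
  -- If γ ≤ G at `x`, the barrier gives γ ≤ -G on [x₁, σ], so v^p - 2s drops by at least G (σ - x₁).
  -- But its limit is at most 0 at `x₁` and equal to 0 at `σ`.
  have hup : ∀ x ∈ Ico (σ - δ) σ, ∀ᶠ n in l, G < phaseRate p (v n x) (d n x) := by
    intro x hx
    by_contra hcon
    have hfreq : ∃ᶠ n in l, phaseRate p (v n x) (d n x) ≤ G :=
      (Filter.not_eventually.1 hcon).mono fun n hn => not_lt.1 hn
    set x₁ := (x + σ) / 2 with hx₁
    have h1 : x < x₁ := by linarith [hx.2]
    have h2 : x₁ < σ := by linarith [hx.2]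
    have hx₁m : x₁ ∈ Icc (σ - δ) (σ + δ) := ⟨by linarith [hx.1], by linarith⟩
    have hz := (B.tendsto_rpow_sub (hmem σ hσm)).sub (B.tendsto_rpow_sub (hmem x₁ hx₁m))
    have hle := B.rpow_le (hmem x₁ hx₁m)
    have hev := hz.eventually (lt_mem_nhds (show -G * (σ - x₁) < _ by
      rw [hσ.eq]
      have : 0 < G * (σ - x₁) := mul_pos hG (by linarith)
      linarith))
    obtain ⟨n, hn, hn', P, hbar, hEn⟩ := (hfreq.and_eventually (hev.and
      ((B.family.eventually_regular ha).and ((B.family.eventually_phaseRate_le_neg ha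
        hG (show 0 < x₁ - x by linarith)).and hE)))).exists
    have h3 := hbar x σ hx.1 (by linarith) (fun s hs => hEn s ⟨hx.1.trans hs.1, by linarith [hs.2]⟩) hn
    have h4 := hmono' n P x₁ σ (-G) hx₁m.1 h2 le_rfl fun s hs =>
      h3 s ⟨by linarith [hs.1], hs.2⟩
    linarith
  -- Applied at `x₁`, `hup` and the barrier give γ ≥ G on all of [x, x₂], so V^p - 2s increases
  -- strictly from `x` to `x₂`, where it is at most 0.
  have hleft : ∀ x ∈ Ico (σ - δ) σ, V x ^ p < 2 * x := by
    intro x hx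
    have hxσ := hx.2
    set x₁ := (x + σ) / 2 with hx₁
    set x₂ := (x + x₁) / 2 with hx₂
    have hxm : x ∈ Icc (σ - δ) (σ + δ) := ⟨hx.1, by linarith⟩
    have hx₂m : x₂ ∈ Icc (σ - δ) (σ + δ) := ⟨by linarith [hx.1], by linarith⟩
    have hz := (B.tendsto_rpow_sub (hmem x₂ hx₂m)).sub (B.tendsto_rpow_sub (hmem x hxm))
    have hle := B.rpow_le (hmem x₂ hx₂m)
    have : G * (x₂ - x) ≤ (V x₂ ^ p - 2 * x₂) - (V x ^ p - 2 * x) := by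
      refine ge_of_tendsto hz ?_
      filter_upwards [hup x₁ ⟨by linarith [hx.1], by linarith⟩, B.family.eventually_regular ha,
        B.family.eventually_phaseRate_le_neg ha hG (show 0 < x₁ - x₂ by linarith), hE]
        with n hn P hbar hEn
      refine hmono n P x x₂ G hx.1 (by linarith) (by linarith) fun s hs => ?_
      by_contra! hlt
      have h3 := hbar s σ (hx.1.trans hs.1) (by linarith)
        (fun t ht => hEn t ⟨hx.1.trans (hs.1.trans ht.1), by linarith [ht.2]⟩) hlt.le x₁
        ⟨by linarith [hs.2], by linarith⟩
      linarith
    have : 0 < G * (x₂ - x) := mul_pos hG (by linarith)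
    linarith
  refine ⟨G, δ, hG, hδ, hδσ, hδ1, hleft, fun x hx y hy => ?_⟩
  have hym : y ∈ Icc (σ - δ) (σ + δ) := ⟨by linarith [hy.1], hy.2⟩
  filter_upwards [hup x hx, (B.tendsto_phaseRate (hmem y hym)).eventually
    (gt_mem_nhds (hright y hy).2), B.family.eventually_regular ha, hE] with n h1 h2 P hEn
  have hxy : x < y := hx.2.trans hy.1
  have hcont : ContinuousOn (fun s => phaseRate p (v n s) (d n s)) (Icc x y) := fun s hs =>
    (P.hasDerivAt_phaseRate B.p_pos ha ⟨hx.1.trans hs.1,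
      by linarith [hs.2, hy.2]⟩).continuousAt.continuousWithinAt
  -- At a zero of γ all the energy is density.
  obtain ⟨q, hq, hq0⟩ := intermediate_value_Ioo' hxy.le hcont ⟨h2, hG.trans h1⟩
  refine ⟨q, hq, ?_⟩
  have h3 := hEn q ⟨hx.1.trans hq.1.le, hq.2.le.trans hy.2⟩
  simp only at hq0
  unfold bubbleEnergy at h3
  rw [hq0] at h3
  linarith

/-- To the left of each contact point there is a further one. -/
theorem exists_next_contact [l.NeBot] (B : BlowUpLimit f p m c₀ τ₀ l μ s₀ v d V D) {σ : ℝ}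
    (hσ : IsContact p V σ) : ∃ σ', σ' < σ ∧ IsContact p V σ' ∧ ∀ s ∈ Ioo σ' σ, V s ^ p < 2 * s := by
  obtain ⟨G, δ, hG, hδ, hδσ, hδ1, hleft, -⟩ := B.exists_bubble hσ
  have hp := B.family.two_lt
  have hσ0 := hσ.pos
  have hσ1 := hσ.le_half
  have hVσ := B.pos (s := σ) ⟨hσ0, by linarith⟩
  have hex : ∃ s ∈ Ioo 0 σ, V s ^ p = 2 * s := by
    by_contra! hcon
    have hlt : ∀ s ∈ Ioo 0 σ, V s ^ p < 2 * s := fun s hs =>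
      lt_of_le_of_ne (B.rpow_le ⟨hs.1, by linarith [hs.2]⟩) (hcon s hs)
    obtain ⟨b, hb, hDb, haff⟩ := B.exists_affine le_rfl hσ0 (by linarith) hlt
    obtain ⟨δ₀, a, hδ₀, hδ₁, hgap, hD, hge, hneg⟩ := B.exists_right_slope hσ
    obtain ⟨C, hC, hlip, -⟩ := B.exists_energy_lower (half_pos hσ0) (by linarith)
    have hσm : σ ∈ Ioo (0 : ℝ) 1 := ⟨hσ0, by linarith⟩
    have hIl : Ioo (σ / 2) σ ∈ 𝓝[<] σ := Ioo_mem_nhdsLT (by linarith)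
    have hIr : Ioo σ (σ + δ₀) ∈ 𝓝[>] σ := Ioo_mem_nhdsGT (by linarith)
    have hl := B.tendsto_phaseRate_of_const (S := Iio σ) (a := b) hσm (by
      filter_upwards [hIl] with s hs using hDb s ⟨by linarith [hs.1], hs.2⟩)
    have hr := B.tendsto_phaseRate_of_const (S := Ioi σ) (a := a) hσm (by
      filter_upwards [hIr] with s hs using hD s hs)
    have hl' := ((hl.pow 2).div_const 2)
    have hr' := ((hr.pow 2).div_const 2)
    -- Energy comparison across `σ`: the slope on the left yields a γ no larger in modulus than the
    -- one on the right, which lies in [-2, 0).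
    have key : ∀ x ∈ Ioo (σ / 2) σ, phaseRate p (V x) (D x) ^ 2 / 2 ≤
        phaseRate p (V σ) a ^ 2 / 2 + C * (σ - x) := by
      intro x hx
      have hid : Tendsto (fun y : ℝ => C * (y - x)) (𝓝[>] σ) (𝓝 (C * (σ - x))) :=
        ((tendsto_id.mono_left nhdsWithin_le_nhds).sub_const x).const_mul C
      refine ge_of_tendsto (hr'.add hid) ?_
      filter_upwards [hIr] with y hy
      have h1 := hlip y ⟨by linarith [hy.1], by linarith [hy.2]⟩ x
        ⟨hx.1.le, by linarith [hx.2]⟩ (hgap y hy) (hlt x ⟨by linarith [hx.1], hx.2⟩)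
      rw [abs_sub_comm x y, abs_of_pos (a := y - x) (by linarith [hx.2, hy.1])] at h1
      linarith [(abs_le.1 h1).2]
    have hle : phaseRate p (V σ) b ^ 2 / 2 ≤ phaseRate p (V σ) a ^ 2 / 2 := by
      have hid : Tendsto (fun x : ℝ => phaseRate p (V σ) a ^ 2 / 2 + C * (σ - x)) (𝓝[<] σ)
          (𝓝 (phaseRate p (V σ) a ^ 2 / 2 + C * (σ - σ))) :=
        (((tendsto_id.mono_left nhdsWithin_le_nhds).const_sub σ).const_mul C).const_add _
      rw [sub_self, mul_zero, add_zero] at hid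
      refine le_of_tendsto_of_tendsto hl' hid ?_
      filter_upwards [hIl] with x hx using key x hx
    have hb2 : phaseRate p (V σ) b ≤ 2 := by nlinarith
    -- The intercept at 0 is squeezed by V ≤ (2s)^(1/p).
    have hint : V σ - b * σ ≤ 0 := by
      have h1 : Tendsto (fun s : ℝ => (V σ + b * (s - σ))) (𝓝[>] 0) (𝓝 (V σ + b * (0 - σ))) :=
        (((tendsto_id.mono_left nhdsWithin_le_nhds).sub_const σ).const_mul b).const_add _
      have h2 : Tendsto (fun s : ℝ => (2 * s) ^ (1 / p)) (𝓝[>] 0) (𝓝 ((2 * 0) ^ (1 / p))) :=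
        ((tendsto_id.mono_left nhdsWithin_le_nhds).const_mul 2).rpow_const
          (Or.inr (by positivity))
      rw [mul_zero, Real.zero_rpow (by positivity)] at h2
      have h3 := le_of_tendsto_of_tendsto h1 h2 (by
        filter_upwards [Ioo_mem_nhdsGT hσ0] with s hs
        rw [← haff σ (right_mem_Icc.2 hσ0.le) s (Ioo_subset_Icc_self hs) hσ0 hs.1]
        have hs1 : s ∈ Ioc (0 : ℝ) 1 := ⟨hs.1, by linarith [hs.2]⟩
        have h4 := Real.rpow_le_rpow (Real.rpow_pos_of_pos (B.pos hs1) p).le (B.rpow_le hs1)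
          (show 0 ≤ 1 / p by positivity)
        rwa [← Real.rpow_mul (B.pos hs1).le, mul_one_div_cancel (by linarith), Real.rpow_one] at h4)
      linarith
    have h5 : V σ ^ p = V σ ^ (p - 1) * V σ := by
      rw [Real.rpow_sub_one hVσ.ne']; field_simp
    have h6 := Real.rpow_pos_of_pos hVσ (p - 1)
    unfold phaseRate at hb2
    have h7 : p * V σ ^ (p - 1) * (V σ - b * σ) ≤ 0 :=
      mul_nonpos_of_nonneg_of_nonpos (by positivity) hint
    have h8 : p * V σ ^ (p - 1) * b * σ ≤ 4 * σ := mul_le_mul_of_nonneg_right (by linarith) hσ0.le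
    -- Since V(σ)^p = 2σ, this would mean p ≤ 2.
    have h9 : p * V σ ^ p ≤ 4 * σ := by rw [h5]; linarith
    rw [hσ.eq] at h9
    nlinarith
  set S := {s ∈ Ioo 0 σ | V s ^ p = 2 * s} with hS
  have hSne : S.Nonempty := by
    obtain ⟨s, hs, he⟩ := hex
    exact ⟨s, hs, he⟩
  -- Contacts do not accumulate at `σ` from the left, so the supremum is a genuinely new contact.
  have hSbdd : ∀ s ∈ S, s ≤ σ - δ := by
    intro s hs
    by_contra! h
    exact (hleft s ⟨h.le, hs.1.2⟩).ne hs.2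
  have hbdd : BddAbove S := ⟨σ - δ, hSbdd⟩
  have hsup_le : sSup S ≤ σ - δ := csSup_le hSne hSbdd
  have hsup_pos : 0 < sSup S := by
    obtain ⟨s, hs⟩ := hSne
    exact hs.1.1.trans_le (le_csSup hbdd hs)
  have hgap : ∀ s ∈ Ioo (sSup S) σ, V s ^ p < 2 * s := by
    intro s hs
    refine lt_of_le_of_ne (B.rpow_le ⟨hsup_pos.trans hs.1, by linarith [hs.2]⟩) fun he => ?_
    exact absurd (le_csSup hbdd (show s ∈ S from ⟨⟨hsup_pos.trans hs.1, hs.2⟩, he⟩)) (not_le.2 hs.1)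
  refine ⟨sSup S, by linarith, ⟨hsup_pos, by linarith, ?_, σ - sSup S, by linarith, by linarith,
    fun s hs => hgap s ⟨hs.1, by linarith [hs.2]⟩⟩, hgap⟩
  have hcl : sSup S ∈ closure S := csSup_mem_closure hSne hbdd
  have := mem_closure_iff_nhdsWithin_neBot.1 hcl
  have hcont : ContinuousAt V (sSup S) :=
    B.continuousOn.continuousAt (Ioc_mem_nhds hsup_pos (by linarith))
  have h1 : Tendsto (fun s => V s ^ p) (𝓝[S] (sSup S)) (𝓝 (V (sSup S) ^ p)) :=
    (hcont.tendsto.rpow_const (Or.inr B.p_pos.le)).mono_left nhdsWithin_le_nhds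
  have h2 : Tendsto (fun s : ℝ => 2 * s) (𝓝[S] (sSup S)) (𝓝 (2 * sSup S)) :=
    (tendsto_id.mono_left nhdsWithin_le_nhds).const_mul 2
  refine tendsto_nhds_unique (h1.congr' ?_) h2
  filter_upwards [self_mem_nhdsWithin] with s hs using hs.2

/-- The limit has infinitely many contact points. -/
theorem exists_contact_seq [l.NeBot] (B : BlowUpLimit f p m c₀ τ₀ l μ s₀ v d V D) :
    ∃ σ : ℕ → ℝ, ∀ k, IsContact p V (σ k) ∧ σ (k + 1) < σ k ∧
      ∀ s ∈ Ioo (σ (k + 1)) (σ k), V s ^ p < 2 * s := by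
  choose g hg using fun x : {σ // IsContact p V σ} => B.exists_next_contact x.2
  let F : ℕ → {σ // IsContact p V σ} := fun k =>
    Nat.rec ⟨1 / 2, B.isContact_half⟩ (fun _ x => ⟨g x, (hg x).2.1⟩) k
  exact ⟨fun k => (F k).1, fun k => ⟨(F k).2, (hg (F k)).1, (hg (F k)).2.2⟩⟩

end BlowUpLimit

end

/-! ### Crossings with the two curves, and the conclusion -/

theorem lowerCurve_exp {p β μ s : ℝ} (hp : 0 < p) (hμ : 0 < μ) (hβ : 0 ≤ β) (hs : 0 ≤ s) :
    lowerCurve p β (Real.exp (-(μ ^ p * s))) = μ * (β * s) ^ (1 / p) := by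
  unfold lowerCurve
  rw [one_div (Real.exp _), Real.log_inv, Real.log_exp, neg_neg,
    show β * (μ ^ p * s) = μ ^ p * (β * s) by ring,
    Real.mul_rpow (Real.rpow_pos_of_pos hμ p).le (by positivity), ← Real.rpow_mul hμ.le,
    mul_one_div_cancel hp.ne', Real.rpow_one]

/-- A lower bound for the bubble density puts the profile above one of the upper curves. -/
theorem exists_upperCurve_lt {ι : Type*} {l : Filter ι} {μ : ι → ℝ} (hμ : Tendsto μ l atTop)
    {p m c₀ a c : ℝ} (hp : 0 < p) (hc₀ : 0 < c₀) (ha : 0 < a) (hc : 0 < c) :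
    ∃ L, ∀ᶠ n in l, ∀ s ∈ Icc a 1, ∀ x ∈ Icc (a / 4) 1, c ≤ bubbleDensity p m c₀ (μ n) x s →
      upperCurve p m L (Real.exp (-(μ n ^ p * s))) < μ n * x := by
  set k := m + p - 1 with hk
  -- The absolute values bound k log x and (k/p) log(2s) on the window; the final -1 makes the
  -- inequality strict.
  set L := Real.log (c / (p * c₀)) - |k| * |Real.log (a / 4)| -
    |k / p| * (|Real.log (2 * a)| + |Real.log 2|) - 1 with hL
  refine ⟨L, ?_⟩
  have hbase : ∀ᶠ T : ℝ in atTop, 0 ≤ T - k / p * Real.log T + L := by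
    have h1 := (Real.isLittleO_log_id_atTop.const_mul_left (k / p)).bound
      (show (0 : ℝ) < 1 / 2 by norm_num)
    filter_upwards [h1, eventually_ge_atTop 0, eventually_ge_atTop (-2 * L)] with T h2 h3 h4
    simp only [id, Real.norm_eq_abs, abs_of_nonneg h3] at h2
    linarith [(abs_le.1 h2).2]
  obtain ⟨T₀, hT₀⟩ := eventually_atTop.1 hbase
  have hT : Tendsto (fun n => μ n ^ p * (2 * a)) l atTop :=
    ((tendsto_rpow_atTop hp).comp hμ).atTop_mul_const (by linarith)
  filter_upwards [hμ.eventually_gt_atTop 0, hT.eventually_ge_atTop T₀] with n hn hTn s hs x hx hF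
  have hΛ := Real.rpow_pos_of_pos hn p
  have hs0 : 0 < s := ha.trans_le hs.1
  have hx0 : 0 < x := lt_of_lt_of_le (by linarith) hx.1
  -- Thus (k/p) log(2 log(1/r)) is k log μ up to a bounded term, matching the factor μ^k of the
  -- density.
  have hlogT : Real.log (2 * (μ n ^ p * s)) = p * Real.log (μ n) + Real.log (2 * s) := by
    rw [show 2 * (μ n ^ p * s) = μ n ^ p * (2 * s) by ring,
      Real.log_mul hΛ.ne' (by positivity), Real.log_rpow hn]
  have hcoef : 1 - (1 - m) / p = k / p := by
    rw [hk]; field_simp; ring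
  have hnonneg := hT₀ (2 * (μ n ^ p * s)) (by nlinarith [hs.1])
  have hlogF : Real.log (c / (p * c₀)) ≤
      k * Real.log (μ n) + k * Real.log x + μ n ^ p * (x ^ p - 2 * s) := by
    have h1 : c / (p * c₀) ≤ μ n ^ k * x ^ k * Real.exp (μ n ^ p * (x ^ p - 2 * s)) := by
      rw [div_le_iff₀ (by positivity)]
      refine hF.trans (le_of_eq ?_)
      unfold bubbleDensity
      ring
    have h2 := Real.log_le_log (by positivity) h1
    have hμk := Real.rpow_pos_of_pos hn k
    have hxk := Real.rpow_pos_of_pos hx0 k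
    rwa [Real.log_mul (by positivity) (Real.exp_pos _).ne', Real.log_mul hμk.ne' hxk.ne',
      Real.log_rpow hn, Real.log_rpow hx0, Real.log_exp] at h2
  have hlogx : k * Real.log x ≤ |k| * |Real.log (a / 4)| := by
    have h1 := Real.log_le_log (by linarith) hx.1
    have h2 := Real.log_nonpos hx0.le hx.2
    refine (le_abs_self _).trans ?_
    rw [abs_mul]
    refine mul_le_mul_of_nonneg_left ?_ (abs_nonneg _)
    rw [abs_of_nonpos h2, abs_of_nonpos (h1.trans h2)]
    linarith
  have hlogs : -(k / p * Real.log (2 * s)) ≤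
      |k / p| * (|Real.log (2 * a)| + |Real.log 2|) := by
    have h1 := Real.log_le_log (by linarith) (show 2 * a ≤ 2 * s by linarith [hs.1])
    have h2 := Real.log_le_log (by linarith) (show 2 * s ≤ 2 by linarith [hs.2])
    refine (neg_le_abs _).trans ?_
    rw [abs_mul]
    refine mul_le_mul_of_nonneg_left (abs_le.2 ⟨?_, ?_⟩) (abs_nonneg _)
    · linarith [neg_abs_le (Real.log (2 * a)), abs_nonneg (Real.log 2)]
    · linarith [le_abs_self (Real.log 2), abs_nonneg (Real.log (2 * a))]
  unfold upperCurve
  rw [one_div (Real.exp _), Real.log_inv, Real.log_exp, neg_neg, hcoef]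
  have hlt : 2 * (μ n ^ p * s) - k / p * Real.log (2 * (μ n ^ p * s)) + L < (μ n * x) ^ p := by
    rw [Real.mul_rpow hn.le hx0.le, hlogT,
      show k / p * (p * Real.log (μ n) + Real.log (2 * s)) =
        k * Real.log (μ n) + k / p * Real.log (2 * s) by field_simp]
    linarith
  have h3 := Real.rpow_lt_rpow hnonneg hlt (show 0 < 1 / p by positivity)
  rwa [← Real.rpow_mul (by positivity), mul_one_div_cancel hp.ne', Real.rpow_one] at h3

theorem StandingAssumption.nonlin_nonneg {h : ℝ → ℝ} (hh : StandingAssumption h) (p t : ℝ)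
    (ht : 0 ≤ t) : 0 ≤ nonlin p h t :=
  mul_nonneg (hh.nonneg t ht) (Real.exp_pos _).le

theorem StandingAssumption.nonlin_bounded {h : ℝ → ℝ} (hh : StandingAssumption h) {p : ℝ}
    (hp : 0 ≤ p) (τ : ℝ) : ∃ C, ∀ t ∈ Icc 0 τ, nonlin p h t ≤ C := by
  obtain ⟨C, hC⟩ := isCompact_Icc.exists_bound_of_continuousOn
    (hh.contDiffOn.continuousOn.mono (show Icc 0 τ ⊆ Ici 0 from fun t ht => ht.1))
  refine ⟨C * Real.exp (τ ^ p), fun t ht => ?_⟩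
  have h1 := (le_abs_self _).trans (hC t ht)
  exact mul_le_mul h1 (Real.exp_le_exp.2 (Real.rpow_le_rpow ht.1 ht.2 hp)) (Real.exp_pos _).le
    ((hh.nonneg t ht.1).trans h1)

theorem natCast_le_zeroNumber {I : Set ℝ} {w g : ℝ → ℝ} (hg : Function.Injective g) {b : ℕ → ℝ}
    {N : ℕ} (hb : ∀ k, b (k + 1) < b k)
    (hz : ∀ k < N, ∃ t ∈ Ioo (b (k + 1)) (b k), g t ∈ I ∧ w (g t) = 0) :
    (N : ℕ∞) ≤ zeroNumber I w := by
  have hanti : StrictAnti b := strictAnti_nat_of_succ_lt hb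
  choose! t ht using hz
  have hinj : InjOn t (Finset.range N : Set ℕ) := by
    have hlt : ∀ i j, i < N → j < N → i < j → t j < t i := by
      intro i j hi hj hij
      exact ((ht j hj).1.2.trans_le (hanti.antitone hij)).trans (ht i hi).1.1
    intro i hi j hj hij
    rw [Finset.coe_range] at hi hj
    rcases lt_trichotomy i j with h | h | h
    · exact absurd hij (hlt i j hi hj h).ne'
    · exact h
    · exact absurd hij (hlt j i hj hi h).ne
  have hsub : g ∘ t '' (Finset.range N : Set ℕ) ⊆ {r ∈ I | w r = 0} := by
    rintro _ ⟨k, hk, rfl⟩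
    rw [Finset.coe_range] at hk
    exact (ht k hk).2
  have hcard := encard_le_encard hsub
  rw [(hg.comp_injOn hinj).encard_image, encard_coe_eq_coe_finsetCard, Finset.card_range] at hcard
  exact hcard

/-- Left of `σ` the profile is below some U_β with β < 2; at the point near `σ` with large density
it is above some V_L. A crossing with `U` lies in between. -/
theorem BlowUpLimit.eventually_exists_eq {ι : Type*} {f : ℝ → ℝ} {p m c₀ τ₀ : ℝ} {l : Filter ι}
    [l.NeBot] {μ s₀ : ι → ℝ} {v d : ι → ℝ → ℝ} {V D : ℝ → ℝ}
    (B : BlowUpLimit f p m c₀ τ₀ l μ s₀ v d V D) {e : ℝ} (he : 0 < e) {U : ℝ → ℝ}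
    (hU : ContinuousOn U (Ioo 0 e))
    (hbounds : ∀ ε ∈ Ioo (0 : ℝ) 2, ∀ L : ℝ, ∃ r₀ ∈ Ioo (0 : ℝ) 1, ∀ r ∈ Ioo 0 r₀,
      lowerCurve p (2 - ε) r ≤ U r ∧ U r ≤ upperCurve p m L r)
    {σ x₀ y₀ : ℝ} (hσ : IsContact p V σ) (hx : x₀ < σ) (hy : σ < y₀) :
    ∀ᶠ n in l, ∃ t ∈ Ioo x₀ y₀, μ n * v n t = U (Real.exp (-(μ n ^ p * t))) := by
  obtain ⟨G, δ, hG, hδ, hδσ, hδ1, hleft, hbub⟩ := B.exists_bubble hσ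
  have hp := B.p_pos
  set x := max (σ - δ) ((x₀ + σ) / 2) with hxdef
  set y := min (σ + δ) y₀ with hydef
  have hx1 : σ - δ ≤ x := le_max_left _ _
  have hx2 : (x₀ + σ) / 2 ≤ x := le_max_right _ _
  have hxσ : x < σ := max_lt (by linarith) (by linarith)
  have hy1 : y ≤ σ + δ := min_le_left _ _
  have hy2 : y ≤ y₀ := min_le_right _ _
  have hyσ : σ < y := lt_min (by linarith) hy
  have hx0 : 0 < x := by linarith
  have hxm : x ∈ Ioc (0 : ℝ) 1 := ⟨hx0, by linarith⟩
  have hVx := B.pos hxm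
  have hVp := Real.rpow_pos_of_pos hVx p
  have hlt := hleft x ⟨hx1, hxσ⟩
  obtain ⟨L, hL⟩ := exists_upperCurve_lt B.family.tendsto_height (m := m) hp B.family.coeff_pos hx0
    (pow_pos hG 2)
  obtain ⟨β, hβ1, hβ2⟩ := exists_between ((div_lt_iff₀ hx0).2 hlt)
  have hβ0 : 0 < β := (div_pos hVp hx0).trans hβ1
  rw [div_lt_iff₀ hx0] at hβ1
  obtain ⟨r₀, hr₀, hcurve⟩ := hbounds (2 - β) ⟨by linarith, by linarith⟩ L
  have hexp : Tendsto (fun n => Real.exp (-(μ n ^ p * x))) l (𝓝 0) :=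
    Real.tendsto_exp_neg_atTop_nhds_zero.comp
      (((tendsto_rpow_atTop hp).comp B.family.tendsto_height).atTop_mul_const hx0)
  have hVlim := ((B.tendsto x hxm).rpow_const (p := p) (Or.inr hp.le)).eventually
    (gt_mem_nhds hβ1)
  filter_upwards [B.family.eventually_regular hx0, hL, hbub x ⟨hx1, hxσ⟩ y ⟨hyσ, hy1⟩,
    hexp.eventually (gt_mem_nhds hr₀.1), hexp.eventually (gt_mem_nhds he), hVlim]
    with n P hLn hqn hr hd hVn
  obtain ⟨q, hq, hFq⟩ := hqn
  have hμ := P.pos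
  have hmono : ∀ t, x ≤ t → Real.exp (-(μ n ^ p * t)) ≤ Real.exp (-(μ n ^ p * x)) := by
    intro t ht
    have := mul_le_mul_of_nonneg_left ht (Real.rpow_pos_of_pos hμ p).le
    exact Real.exp_le_exp.2 (by linarith)
  have hqI : q ∈ Icc x 1 := ⟨hq.1.le, by linarith [hq.2]⟩
  have hxI : x ∈ Icc x 1 := left_mem_Icc.2 hxm.2
  have hlow : μ n * v n x < U (Real.exp (-(μ n ^ p * x))) := by
    refine lt_of_lt_of_le ?_ (hcurve _ ⟨Real.exp_pos _, hr⟩).1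
    rw [sub_sub_cancel, lowerCurve_exp hp hμ hβ0.le hx0.le]
    have hvx : 0 < v n x := lt_of_lt_of_le (by linarith) (P.lower x hxI)
    refine mul_lt_mul_of_pos_left ?_ hμ
    have := Real.rpow_lt_rpow (Real.rpow_pos_of_pos hvx p).le hVn (show 0 < 1 / p by positivity)
    rwa [← Real.rpow_mul hvx.le, mul_one_div_cancel hp.ne', Real.rpow_one] at this
  have hupp : U (Real.exp (-(μ n ^ p * q))) < μ n * v n q :=
    ((hcurve _ ⟨Real.exp_pos _, (hmono q hqI.1).trans_lt hr⟩).2).trans_lt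
      (hLn q hqI _ ⟨P.lower q hqI, P.upper q hqI⟩ hFq)
  have hcont : ContinuousOn (fun t => μ n * v n t - U (Real.exp (-(μ n ^ p * t)))) (Icc x q) := by
    refine ContinuousOn.sub (continuousOn_const.mul fun t ht => ?_) (hU.comp ?_ fun t ht => ?_)
    · exact (P.hasDerivAt t ⟨ht.1, ht.2.trans hqI.2⟩).continuousAt.continuousWithinAt
    · fun_prop
    · exact ⟨Real.exp_pos _, (hmono t ht.1).trans_lt hd⟩
  obtain ⟨t, ht, ht0⟩ := intermediate_value_Ioo hqI.1 hcont
    ⟨sub_neg.2 hlow, sub_pos.2 hupp⟩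
  exact ⟨t, ⟨by linarith [ht.1], by linarith [ht.2, hq.2]⟩, sub_eq_zero.1 ht0⟩

theorem corollary4p6
    (p : ℝ) (hp : 2 < p)
    (h : ℝ → ℝ) (hh : StandingAssumption h)
    (c₀ τ₀ m : ℝ) (hc₀ : 0 < c₀) (hτ₀ : 0 < τ₀)
    (hf : ∀ t, τ₀ ≤ t → nonlin p h t = c₀ * t ^ m * Real.exp (t ^ p))
    (R μ : ℕ → ℝ) (u : ℕ → ℝ → ℝ)
    (hu : ∀ n, IsRadialSolution (nonlin p h) (R n) (μ n) (u n))
    (hμ : Tendsto μ atTop atTop)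
    -- `U` is a continuous function on some interval `(0, d)`
    (d : ℝ) (hd : 0 < d) (U : ℝ → ℝ) (hU : ContinuousOn U (Ioo 0 d))
    (hbounds : ∀ ε ∈ Ioo (0 : ℝ) 2, ∀ L : ℝ, ∃ r₀ ∈ Ioo (0 : ℝ) 1, ∀ r ∈ Ioo 0 r₀,
      lowerCurve p (2 - ε) r ≤ U r ∧ U r ≤ upperCurve p m L r)
    (r : ℕ → ℝ) (hr : ∀ n, r n ∈ Ioc 0 (R n))
    (hlog : Tendsto (fun n => (μ n) ^ (-p) * Real.log (1 / r n)) atTop (𝓝 0)) :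
    -- zeros are counted on the part of `(0, r n)` on which `U` is defined
    Tendsto (fun n => zeroNumber (Ioo 0 (r n) ∩ Ioo 0 d) (fun s => u n s - U s))
      atTop (𝓝 ⊤) := by
  have hp0 : 0 < p := by linarith
  rw [ENat.tendsto_nhds_top_iff_natCast_lt]
  intro N
  by_contra hcon
  have hfreq := Filter.not_eventually.1 hcon
  -- An ultrafilter on the bad indices replaces the extraction of a convergent subsequence.
  obtain ⟨l, hl'⟩ := @exists_ultrafilter_le _ _ (frequently_mem_iff_neBot.1 hfreq)
  have hl := hl'.trans inf_le_left
  have hbad := le_principal_iff.1 (hl'.trans inf_le_right)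
  have hμl : Tendsto μ l atTop := hμ.mono_left hl
  have hμ0 := hμl.eventually_gt_atTop 0
  have hstart : ∀ a, 0 < a → ∀ᶠ n in (l : Filter ℕ), μ n ^ (-p) * Real.log (1 / r n) < a :=
    fun a ha => hl (hlog.eventually (gt_mem_nhds ha))
  have hfam : BlowUpFamily (nonlin p h) p m c₀ τ₀ (l : Filter ℕ) μ
      (fun n => μ n ^ (-p) * Real.log (1 / R n))
      (fun n s => u n (Real.exp (-(μ n ^ p * s))) / μ n)
      (fun n s => -(μ n ^ (p - 1) * (Real.exp (-(μ n ^ p * s)) *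
        deriv (u n) (Real.exp (-(μ n ^ p * s)))))) := by
    refine ⟨hp, hc₀, hτ₀, hh.nonlin_nonneg p, hf, hh.nonlin_bounded hp0.le τ₀, hμl,
      fun a ha => ?_, ?_⟩
    · filter_upwards [hstart a ha, hμ0] with n hn hn0
      refine lt_of_le_of_lt (mul_le_mul_of_nonneg_left ?_ (Real.rpow_pos_of_pos hn0 _).le) hn
      have h1 := (hr n).1
      exact Real.log_le_log (one_div_pos.2 (hu n).radius_pos)
        (one_div_le_one_div_of_le h1 (hr n).2)
    · filter_upwards [hμ0] with n hn using (hu n).logProfile hn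
  obtain ⟨V, D, B⟩ := hfam.exists_limit
  obtain ⟨σ, hσ⟩ := B.exists_contact_seq
  -- Midpoints separate the contacts: the interval from `b (k + 1)` to `b k` contains `σ (k + 1)`,
  -- so `σ 0` is not used.
  set b : ℕ → ℝ := fun k => (σ k + σ (k + 1)) / 2 with hb
  have hbpos : 0 < b (N + 1) := by
    have := (hσ (N + 1)).1.pos
    have := (hσ (N + 2)).1.pos
    simp only [hb]
    linarith
  have hbanti : ∀ k, b (k + 1) < b k := fun k => by
    have := (hσ k).2.1
    have := (hσ (k + 1)).2.1
    simp only [hb]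
    linarith
  have hz : ∀ᶠ n in (l : Filter ℕ), ∀ k < N + 1, ∃ t ∈ Ioo (b (k + 1)) (b k),
      μ n * (u n (Real.exp (-(μ n ^ p * t))) / μ n) = U (Real.exp (-(μ n ^ p * t))) := by
    refine (eventually_all_finite (Set.finite_lt_nat (N + 1))).2 fun k _ => ?_
    have h1 := (hσ k).2.1
    have h2 := (hσ (k + 1)).2.1
    exact B.eventually_exists_eq hd hU hbounds (hσ (k + 1)).1 (by simp only [hb]; linarith)
      (by simp only [hb]; linarith)
  have hexp : Tendsto (fun n => Real.exp (-(μ n ^ p * b (N + 1)))) l (𝓝 0) :=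
    Real.tendsto_exp_neg_atTop_nhds_zero.comp
      (((tendsto_rpow_atTop hp0).comp hμl).atTop_mul_const hbpos)
  obtain ⟨n, hbadn, hzn, hdn, hsn, hn0⟩ := (Filter.Eventually.and hbad (hz.and
    ((hexp.eventually (gt_mem_nhds hd)).and ((hstart _ hbpos).and hμ0)))).exists
  refine hbadn (lt_of_lt_of_le (by exact_mod_cast N.lt_succ_self)
    (natCast_le_zeroNumber (N := N + 1) (g := fun t => Real.exp (-(μ n ^ p * t))) ?_ hbanti
      fun k hk => ?_))
  · intro s t hst
    have h1 := Real.exp_injective hst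
    have h2 := Real.rpow_pos_of_pos hn0 p
    exact mul_left_cancel₀ h2.ne' (neg_injective h1)
  · obtain ⟨t, ht, hteq⟩ := hzn k hk
    rw [mul_div_cancel₀ _ hn0.ne'] at hteq
    have hΛ := Real.rpow_pos_of_pos hn0 p
    have hbt : b (N + 1) ≤ t :=
      ((strictAnti_nat_of_succ_lt hbanti).antitone (show k + 1 ≤ N + 1 by omega)).trans ht.1.le
    have hle : Real.exp (-(μ n ^ p * t)) ≤ Real.exp (-(μ n ^ p * b (N + 1))) := by
      have := mul_le_mul_of_nonneg_left hbt hΛ.le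
      exact Real.exp_le_exp.2 (by linarith)
    refine ⟨t, ht, ⟨⟨Real.exp_pos _, hle.trans_lt ?_⟩, Real.exp_pos _, hle.trans_lt hdn⟩,
      sub_eq_zero.2 hteq⟩
    rw [Real.rpow_neg hn0.le, inv_mul_lt_iff₀ hΛ, one_div, Real.log_inv] at hsn
    rw [← Real.lt_log_iff_exp_lt (hr n).1]
    linarith
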